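/- Let $r\ge 1$. An $r$-permutation of $[n]=\{1,\dots,n\}$ is a rearrangement $a_1a_2\cdots a_{rn}$ of the multiset $\{1^r,2^r,\dots,n^r\}$ such that $i<j<k$ and $a_i=a_k$ imply $a_j\le a_i$. The stack-sorting operation $S$ is defined recursively on words: $S(\emptyset)=\emptyset$, and if $m$ is the largest letter of a nonempty word $w=\alpha_1m\alpha_2m\cdots m\alpha_{s}$, where $m$ does not occur in any $\alpha_j$ (the $\alpha_j$ may be empty), then $S(w)=S(\alpha_1)S(\alpha_2)\cdots S(\alpha_{s})\,m$. An $r$-permutation $\pi$ of $[n]$ is two-stack-sortable if $S(S(\pi))=12\cdots n$. A letter $a$ of $\pi$ is a type $0$ descent if its first occurrence immediately follows a smaller letter, and a type $i$ descent ($1\le i\le r$) if its $i$th occurrence is immediately followed by a smaller letter. Theorem. Let $r\ge1$, let $k_0,\dots,k_r$ be nonnegative integers, and put $n=1+k_0+k_1+\cdots+k_r$. The number of nonempty two-stack-sortable $r$-permutations (of $[m]$ for an arbitrary $m\ge 1$) having exactly $k_i$ descents of type $i$ for every $i=0,1,\dots,r$ is $$\frac{1}{n^2}\prod_{i=0}^{r}\frac{n}{n-k_i}\binom{2n-1-k_i}{k_i}.$$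 In particular, for $r=1$, so that $n=1+k_0+k_1$, this number is $$\frac{(n+k_1)!\,(2n-1-k_1)!}{(k_1+1)!\,(2k_1+1)!\,(n-k_1)!\,(2n-1-2k_1)!}.$$ -/

import Mathlib

/-- `w` is an `r`-permutation of `[n] = {1, …, n}`: a rearrangement of the multiset
`{1^r, 2^r, …, n^r}` in which no letter between two equal letters is larger than them. -/
def IsRPermutation (r n : ℕ) (w : List ℕ) : Prop :=
  (∀ a : ℕ, w.count a = if 1 ≤ a ∧ a ≤ n then r else 0) ∧
    ∀ i j k : Fin w.length, i < j → j < k → w.get i = w.get k → w.get j ≤ w.get i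

/-- The largest letter of a word of natural numbers (`0` for the empty word). -/
def maxLetter (w : List ℕ) : ℕ := w.foldr max 0

theorem maxLetter_mem : ∀ {w : List ℕ}, w ≠ [] → maxLetter w ∈ w
  | [a], _ => by simp [maxLetter]
  | a :: b :: w, _ => by
    have ih : maxLetter (b :: w) ∈ b :: w := maxLetter_mem (by simp)
    have h : maxLetter (a :: b :: w) = max a (maxLetter (b :: w)) := rfl
    rcases max_choice a (maxLetter (b :: w)) with h' | h' <;> rw [h, h']
    · exact List.mem_cons_self
    · exact List.mem_cons_of_mem _ ih

theorem length_lt_of_mem_splitOn {w u : List ℕ} {m : ℕ} (hm : m ∈ w)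
    (hu : u ∈ w.splitOn m) : u.length < w.length := by
  have key : ∀ (w u : List ℕ), u ∈ w.splitOn m → u.length + w.count m ≤ w.length := by
    intro w
    induction w with
    | nil => intro u hu; simp_all [List.splitOn]
    | cons a w ih =>
      intro u hu
      by_cases ha : a = m
      · subst ha
        have hu' : u = [] ∨ u ∈ w.splitOn a := by
          simpa [List.splitOn, List.splitOnP_cons_eq_if_modifyHead] using hu
        have hc : w.count a ≤ w.length := List.count_le_length
        rcases hu' with rfl | h
        · simp; omega
        · have := ih u h
          simp; omega
      · have hu' : u ∈ (w.splitOn m).modifyHead (List.cons a) := by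
          simpa [List.splitOn, List.splitOnP_cons_eq_if_modifyHead, ha] using hu
        rcases hs : w.splitOn m with _ | ⟨x, l⟩
        · simp [hs] at hu'
        · rw [hs] at hu' ih
          have hu'' : u = a :: x ∨ u ∈ l := by simpa using hu'
          have hcount : (a :: w).count m = w.count m := by simp [ha]
          rw [hcount]
          rcases hu'' with rfl | h
          · have := ih x (by simp)
            simp; omega
          · have := ih u (by simp [h])
            simp; omega
  have h1 := key w u hu
  have h2 : 0 < w.count m := List.count_pos_iff.mpr hm
  omega

/-- The stack-sorting operation. If `m` is the largest letter of a nonempty word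
`w = α₁ m α₂ m ⋯ m αₛ` (with `m` in none of the `αⱼ`), then `S(w) = S(α₁) S(α₂) ⋯ S(αₛ) m`;
the empty word is fixed. (`List.splitOn` returns the list `[α₁, …, αₛ]`, empty `αⱼ` included.) -/
def stackSort (w : List ℕ) : List ℕ :=
  if _h : w = [] then []
  else ((w.splitOn (maxLetter w)).attach.map fun α => stackSort α.1).flatten ++ [maxLetter w]
termination_by w.length
decreasing_by exact length_lt_of_mem_splitOn (maxLetter_mem _h) α.2

theorem stackSort_nil : stackSort [] = [] := by
  rw [stackSort]; simp

theorem stackSort_of_ne_nil {w : List ℕ} (h : w ≠ []) :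
    stackSort w = ((w.splitOn (maxLetter w)).map stackSort).flatten ++ [maxLetter w] := by
  rw [stackSort, dif_neg h, List.attach_map_val]

/-- `IsDescent w i a`: the letter `a` is a type `i` descent of `w`. For `i = 0`, the first
occurrence of `a` immediately follows a smaller letter; for `i ≥ 1`, the `i`-th occurrence of `a`
is immediately followed by a smaller letter. -/
def IsDescent (w : List ℕ) : ℕ → ℕ → Prop
  | 0, a => ∃ (u v : List ℕ) (b : ℕ), w = u ++ b :: a :: v ∧ b < a ∧ a ∉ u
  | i + 1, a => ∃ (u v : List ℕ) (b : ℕ), w = u ++ a :: b :: v ∧ b < a ∧ u.count a = i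

/-- The set of letters that are type `i` descents of `w`. -/
def descents (w : List ℕ) (i : ℕ) : Set ℕ := {a | IsDescent w i a}

/-- The set of two-stack-sortable `r`-permutations, of `[m]` for an arbitrary `m ≥ 1`,
that have exactly `k i` descents of type `i` for every `i = 0, 1, …, r`. -/
def twoStackSortableWithDescents (r : ℕ) (k : Fin (r + 1) → ℕ) : Set (List ℕ) :=
  {w | (∃ m : ℕ, 1 ≤ m ∧ IsRPermutation r m w ∧
      stackSort (stackSort w) = List.range' 1 m) ∧
    ∀ i : Fin (r + 1), (descents w i).ncard = k i}

/-! ### Kernel polynomials and the reflection T ↔ 1/T -/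

section KernelPolynomials

open Polynomial
open LaurentPolynomial hiding C

variable {B : Type*} [CommRing B]

/-! The proof decomposes words into a functional equation with one catalytic variable, solves it by
a kernel parametrization, and extracts coefficients by Lagrange inversion.

Decomposition. For an `r`-permutation `w` the word `S(w)` has distinct letters, so `S(S(w))` is
increasing iff `S(w)` avoids 231 (`pairwise_stackSort_iff`). Cutting `w` at its maximum gives `r +
1` possibly empty words, and the maximum is a type `i` descent iff slot `i` is nonempty
(`isDescent_intercalate_self`). Build such a forest from the right. When a tree is put in front of a
forest `F`, avoidance forces its non-root letters below all letters of `F`, and its root must sit at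
a level where the image of `F` has all smaller letters before all larger ones. These levels are 0
and the cut letters (`avoids231_merge`, `consForest_mem_iff`). With `y` marking cut letters, `z`
size and `x_j` nonempty slots, summing over the level gives (`catalyticSystem_treeSeries`) (1 -
y)(H_{j+1} - H_j) = x_j A (H_j(1) - y H_j), H_0 = 1, A = z y H_{r+1}.

Solution. Let b_i = 1 - x_i t b_i², a_i = 1 - b_i, z = t ∏ b_i², Q(s) = ∏ (1 - a_i s), and define
`s` by s = 1 - y Q(s), so that y = 1 corresponds to s = 0. Put A = t (1 - s)(Q(s) - 1 + s)/s and H_j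
= K_j(s) ∏_{i<j} b_i⁻². Since s(1 - a)² - a(1 - s)² = (1 - a s)(s - a), each equation becomes the
recursion of `kernelPoly`; its roots `a` and 1/`a` are exchanged by s ↔ 1/s, and this symmetry
yields the closing identity s K_n = Q (Q - 1 + s) (`X_mul_kernelPoly`). The system has only one
solution (`CatalyticSystem.unique`), so A at y = 1 is t (1 - ∑ a_i).

Extraction. Seen as a series F in z, this value satisfies z F'(z) = t (`derivative_solutionSeries`),
so n² [zⁿ] F = [tⁿ⁻¹] ∏ b_i⁻²ⁿ (`sq_mul_coeff_of_derivative_subst_eq`). The factors involve separate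
variables, and Lucas polynomials give the coefficients of each (`coeff_catalanFactorInv_pow`). -/

theorem trunc_invert_toLaurent (p : B[X]) :
    LaurentPolynomial.trunc (invert (toLaurent p)) = Polynomial.C (p.coeff 0) := by
  induction p using Polynomial.induction_on' with
  | add p q hp hq => simp [hp, hq]
  | monomial n a =>
    rw [← Polynomial.C_mul_X_pow_eq_monomial, toLaurent_C_mul_X_pow, map_mul, invert_C, invert_T,
      trunc_C_mul_T]
    rcases n with _ | n
    · simp
    · rw [if_neg (by omega)]
      simp

theorem trunc_T_mul_invert_toLaurent (p : B[X]) :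
    LaurentPolynomial.trunc (T 1 * invert (toLaurent p)) =
      Polynomial.C (p.coeff 0) * X + Polynomial.C (p.coeff 1) := by
  induction p using Polynomial.induction_on' with
  | add p q hp hq => simp only [map_add, mul_add, hp, hq, Polynomial.coeff_add]; ring
  | monomial n a =>
    rw [← Polynomial.C_mul_X_pow_eq_monomial, toLaurent_C_mul_X_pow, map_mul invert, invert_C,
      invert_T, T_mul, mul_assoc, ← T_add, trunc_C_mul_T]
    rcases n with _ | _ | n
    · simp [← Polynomial.C_mul_X_pow_eq_monomial, Polynomial.coeff_C]
    · simp [Polynomial.coeff_X]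
    · rw [if_neg (by push_cast; omega)]
      simp [Polynomial.coeff_X_pow]

/-- A Laurent polynomial that becomes a polynomial after multiplication by a polynomial with
constant coefficient one is a polynomial. -/
theorem exists_toLaurent_eq_of_mul_eq {Q K : B[X]} (hQ : Q.coeff 0 = 1) {f : B[T;T⁻¹]}
    (h : toLaurent Q * f = toLaurent K) : ∃ l : B[X], toLaurent l = f := by
  obtain ⟨N, p, hp⟩ := exists_T_pow f
  have h1 : Q * p = K * X ^ N := by
    apply toLaurent_injective
    rw [map_mul, map_mul, hp, toLaurent_X_pow, ← h, mul_assoc]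
  have hcop : IsCoprime Q (X ^ N : B[X]) := by
    apply IsCoprime.pow_right
    refine ⟨1, -Q.divX, ?_⟩
    have := Q.divX_mul_X_add
    rw [hQ] at this
    nth_rewrite 1 [← this]
    simp
  obtain ⟨l, hl⟩ : X ^ N ∣ p := hcop.symm.dvd_of_dvd_mul_left ⟨K, by rw [h1, mul_comm]⟩
  refine ⟨l, ?_⟩
  rw [hl, map_mul, toLaurent_X_pow] at hp
  exact (isUnit_T (N : ℤ)).mul_left_inj.mp (by rw [← hp, mul_comm])

/-- The polynomials obtained from the kernel method: `K₀ = 1` and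
`X Kⱼ₊₁ = (1 - aⱼ X) (X - aⱼ) Kⱼ + aⱼ Kⱼ(0) (1 - X) Q`. -/
noncomputable def kernelPoly (a : ℕ → B) (Q : B[X]) : ℕ → B[X]
  | 0 => 1
  | j + 1 => (1 - C (a j) * X) * kernelPoly a Q j -
      C (a j) * ((1 - C (a j) * X) * kernelPoly a Q j -
        C ((kernelPoly a Q j).coeff 0) * ((1 - X) * Q)).divX

/-- As Q(0) = 1, the polynomial under `divX` has zero constant term, so the division by `X` is
exact. -/
theorem X_mul_kernelPoly_succ (a : ℕ → B) {Q : B[X]} (hQ : Q.coeff 0 = 1) (j : ℕ) :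
    X * kernelPoly a Q (j + 1) =
      (1 - C (a j) * X) * (X - C (a j)) * kernelPoly a Q j +
        C (a j) * C ((kernelPoly a Q j).coeff 0) * ((1 - X) * Q) := by
  rw [kernelPoly]
  set E := (1 - C (a j) * X) * kernelPoly a Q j -
        C ((kernelPoly a Q j).coeff 0) * ((1 - X) * Q) with hE
  have h0 : E.coeff 0 = 0 := by
    simp [hE, Polynomial.mul_coeff_zero, hQ]
  have h1 : X * E.divX = E := by
    have := E.X_mul_divX_add
    rwa [h0, map_zero, add_zero] at this
  linear_combination (-C (a j)) * h1

/-- The kernel (1 - a T)(T - a) is T times the symmetric factor (1 - a T)(1 - a T⁻¹), which the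
remaining product absorbs. The unknown constants K_j(0) only enter the part `S` invariant under T ↔
T⁻¹. -/
theorem kernelPoly_reflection (a : ℕ → B) (n : ℕ) {Q : B[X]} (hQ0 : Q.coeff 0 = 1)
    (hQ : Q = ∏ i ∈ Finset.range n, (1 - C (a i) * X)) (j : ℕ) (hj : j ≤ n) :
    ∃ S : B[T;T⁻¹], invert S = S ∧
      T 1 * toLaurent (kernelPoly a Q j) *
        (∏ i ∈ Finset.Ico j n, (1 - LaurentPolynomial.C (a i) * T 1)) *
          (∏ i ∈ Finset.Ico j n, (1 - LaurentPolynomial.C (a i) * T (-1))) =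
        toLaurent Q * (T 1 * invert (toLaurent Q) + (1 - T 1) * S) := by
  have hT : (T 1 * T (-1) : B[T;T⁻¹]) = 1 := by rw [← T_add]; simp
  induction j with
  | zero =>
    refine ⟨0, by simp, ?_⟩
    have e1 : toLaurent Q = ∏ i ∈ Finset.Ico 0 n, (1 - LaurentPolynomial.C (a i) * T 1) := by
      simp [hQ, map_prod]
    have e2 : invert (toLaurent Q) =
        ∏ i ∈ Finset.Ico 0 n, (1 - LaurentPolynomial.C (a i) * T (-1)) := by
      simp [hQ, map_prod]
    rw [e2, e1, kernelPoly]
    simp only [map_one]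
    ring
  | succ j ih =>
    obtain ⟨S, hS, h⟩ := ih (by omega)
    simp only [Finset.prod_eq_prod_Ico_succ_bot (show j < n by omega)] at h
    set R := ∏ i ∈ Finset.Ico (j + 1) n, (1 - LaurentPolynomial.C (a i) * T 1) with hR
    set R' := ∏ i ∈ Finset.Ico (j + 1) n, (1 - LaurentPolynomial.C (a i) * T (-1)) with hR'
    have i1 : invert R = R' := by simp [hR, hR', map_prod]
    have i2 : invert R' = R := by simp [hR, hR', map_prod]
    refine ⟨S + LaurentPolynomial.C (a j * (kernelPoly a Q j).coeff 0) * (R * R'), ?_, ?_⟩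
    · simp only [map_add, map_mul, hS, invert_C, i1, i2]
      ring
    · have h2 := congrArg toLaurent (X_mul_kernelPoly_succ a hQ0 j)
      simp only [map_mul, map_add, map_sub, map_one, toLaurent_X, toLaurent_C] at h2
      simp only [map_mul]
      linear_combination (R * R') * h2 + h +
        (1 - LaurentPolynomial.C (a j) * T 1) * R * R' * toLaurent (kernelPoly a Q j)
          * LaurentPolynomial.C (a j) * hT

/-- At j = n the reflection identity exhibits K_n / Q as a Laurent polynomial, hence a polynomial l.
In T l(T) + l(1/T) the unknown symmetric part cancels, and the nonnegative powers then determine l.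
-/
theorem X_mul_kernelPoly (a : ℕ → B) (n : ℕ) {Q : B[X]}
    (hQ : Q = ∏ i ∈ Finset.range n, (1 - C (a i) * X)) :
    X * kernelPoly a Q n = Q * (Q - 1 + X) := by
  have hQ0 : Q.coeff 0 = 1 := by
    simp [hQ, Polynomial.coeff_zero_eq_eval_zero, Polynomial.eval_prod]
  have hT : (T 1 * T (-1) : B[T;T⁻¹]) = 1 := by rw [← T_add]; simp
  obtain ⟨S, hS, h⟩ := kernelPoly_reflection a n hQ0 hQ n le_rfl
  simp only [Finset.Ico_self, Finset.prod_empty, mul_one] at h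
  obtain ⟨l, hl⟩ := exists_toLaurent_eq_of_mul_eq (K := kernelPoly a Q n) hQ0
    (f := invert (toLaurent Q) + (T (-1) - 1) * S) (by
      linear_combination (-T (-1)) * h + (toLaurent (kernelPoly a Q n) -
        toLaurent Q * invert (toLaurent Q) + toLaurent Q * S) * hT)
  have hK : kernelPoly a Q n = Q * l := by
    apply toLaurent_injective
    rw [map_mul, hl]
    linear_combination (T (-1)) * h - (toLaurent (kernelPoly a Q n) -
        toLaurent Q * invert (toLaurent Q) + toLaurent Q * S) * hT
  have hinv : invert (toLaurent l) = toLaurent Q + (T 1 - 1) * S := by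
    rw [hl]
    simp only [map_add, map_mul, map_sub, map_one, invert_T, hS, neg_neg]
    rw [involutive_invert]
  have hsum : toLaurent (X * l) + invert (toLaurent l) =
      T 1 * invert (toLaurent Q) + toLaurent Q := by
    rw [hinv, map_mul, hl, toLaurent_X]
    linear_combination S * hT
  -- Discarding negative powers gives X l + l(0) = Q + X + Q₁, with Q₁ the linear coefficient; the
  -- constant terms then give l(0) = 1 + Q₁.
  have htr := congrArg LaurentPolynomial.trunc hsum
  rw [map_add, map_add, trunc_toLaurent, trunc_invert_toLaurent, trunc_T_mul_invert_toLaurent,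
    trunc_toLaurent, hQ0] at htr
  have h0 := congrArg (Polynomial.coeff · 0) htr
  simp [hQ0] at h0
  rw [hK]
  rw [h0] at htr
  simp only [map_add, map_one] at htr
  linear_combination Q * htr

end KernelPolynomials

/-! ### Lagrange inversion -/

section LagrangeInversion

open PowerSeries

theorem PowerSeries.coeff_X_mul_derivative {R : Type*} [CommRing R] (f : R⟦X⟧) (n : ℕ) :
    coeff n (X * derivative R f) = n * coeff n f := by
  cases n with
  | zero => simp
  | succ n => rw [coeff_succ_X_mul, coeff_derivative]; push_cast; ring

variable {R : Type*} [CommRing R] [IsDomain R] [CharZero R]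

/-- With Φ = X/ζ this is the residue of ζ'/ζⁿ⁺¹, which vanishes for n > 0 because the form is exact.
The proof avoids Laurent series and uses characteristic zero. -/
theorem coeff_derivative_mul_pow {ζ Φ : R⟦X⟧} (h0 : constantCoeff ζ = 0) (h : ζ * Φ = X) (n : ℕ) :
    coeff n (derivative R ζ * Φ ^ (n + 1)) = if n = 0 then 1 else 0 := by
  have hd : ζ * derivative R Φ + Φ * derivative R ζ = 1 := by
    have := congrArg (derivative R) h
    simpa using this
  rcases n with _ | n
  · have hc := congrArg (coeff 0) hd
    simp [h0] at hc ⊢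
    rw [mul_comm]; exact hc
  · have h1 : ((n + 1 : ℕ) : R) * coeff (n + 1) (derivative R ζ * Φ ^ (n + 1 + 1)) = 0 := by
      have e : derivative R ζ * Φ ^ (n + 1 + 1) = Φ ^ (n + 1) - X * (Φ ^ n * derivative R Φ) := by
        rw [← h]
        linear_combination (Φ ^ (n + 1)) * hd
      have e2 : ((n + 1 : ℕ) : R⟦X⟧) * (X * (Φ ^ n * derivative R Φ)) =
          X * derivative R (Φ ^ (n + 1)) := by
        rw [derivative_pow]; push_cast [Nat.add_sub_cancel]; ring
      have e3 : ((n + 1 : ℕ) : R) * coeff (n + 1) (X * (Φ ^ n * derivative R Φ)) =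
          (n + 1 : ℕ) * coeff (n + 1) (Φ ^ (n + 1)) := by
        rw [← PowerSeries.coeff_X_mul_derivative (Φ ^ (n + 1)), ← e2, ← nsmul_eq_mul,
          ← nsmul_eq_mul, map_nsmul]
      rw [e, map_sub, mul_sub, e3, sub_self]
    rw [if_neg (by omega)]
    exact (mul_eq_zero.mp h1).resolve_left (by exact_mod_cast Nat.succ_ne_zero n)

/-- Peel off the constant term of `G`: constants are covered by the residue computation, and the
remaining factor ζ combines with one Φ into `X`, lowering n by one. -/
theorem coeff_subst_mul_derivative_mul_pow {ζ Φ : R⟦X⟧} (h0 : constantCoeff ζ = 0)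
    (h : ζ * Φ = X) (n : ℕ) (G : R⟦X⟧) :
    coeff n (G.subst ζ * derivative R ζ * Φ ^ (n + 1)) = coeff n G := by
  have hs : HasSubst ζ := HasSubst.of_constantCoeff_zero' h0
  have key : ∀ n, ∀ g0 : R, coeff n (C g0 * derivative R ζ * Φ ^ (n + 1)) =
      coeff n (C g0) := by
    intro n g0
    rw [mul_assoc, coeff_C_mul, coeff_derivative_mul_pow h0 h, coeff_C]
    split_ifs <;> simp
  have dec : ∀ G : R⟦X⟧, ∃ G1 g0, G = X * G1 + C g0 ∧ G.subst ζ = ζ * G1.subst ζ + C g0 := by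
    intro G
    refine ⟨_, _, eq_X_mul_shift_add_const G, ?_⟩
    conv_lhs => rw [eq_X_mul_shift_add_const G]
    rw [subst_add hs, subst_mul hs, subst_X hs, subst_C]
    rfl
  induction n generalizing G with
  | zero =>
    obtain ⟨G1, g0, e1, e2⟩ := dec G
    rw [e2, add_mul, add_mul, map_add, key, e1, map_add]
    simp [h0]
  | succ n ih =>
    obtain ⟨G1, g0, e1, e2⟩ := dec G
    have e3 : ζ * G1.subst ζ * derivative R ζ * Φ ^ (n + 1 + 1) =
        X * (G1.subst ζ * derivative R ζ * Φ ^ (n + 1)) := by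
      rw [← h]; ring
    rw [e2, add_mul, add_mul, map_add, key, e3, coeff_succ_X_mul, ih, e1, map_add,
      coeff_succ_X_mul]

/-- A special case of Lagrange inversion: if `z = t / Φ(t)` and the series `F` satisfies
`z F'(z) = t`, then `n² [zⁿ] F = [tⁿ⁻¹] Φⁿ`. -/
theorem sq_mul_coeff_of_derivative_subst_eq {ζ Φ F : R⟦X⟧} (h0 : constantCoeff ζ = 0)
    (h : ζ * Φ = X) (hF : derivative R (F.subst ζ) = derivative R ζ * Φ) (n : ℕ) :
    ((n + 1 : ℕ) : R) ^ 2 * coeff (n + 1) F = coeff n (Φ ^ (n + 1)) := by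
  have hs : HasSubst ζ := HasSubst.of_constantCoeff_zero' h0
  have hd : ζ * derivative R Φ + Φ * derivative R ζ = 1 := by
    have := congrArg (derivative R) h
    simpa using this
  have h1 : ((n + 1 : ℕ) : R) * coeff (n + 1) F = coeff n (derivative R ζ * Φ ^ (n + 2)) := by
    have := coeff_subst_mul_derivative_mul_pow h0 h n (derivative R F)
    rw [← derivative_subst hs, hF, coeff_derivative] at this
    push_cast
    rw [mul_comm, ← this]
    congr 1
    ring
  have e : derivative R ζ * Φ ^ (n + 2) = Φ ^ (n + 1) - X * (Φ ^ n * derivative R Φ) := by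
    rw [← h]
    linear_combination (Φ ^ (n + 1)) * hd
  have e2 : ((n + 1 : ℕ) : R⟦X⟧) * (X * (Φ ^ n * derivative R Φ)) =
      X * derivative R (Φ ^ (n + 1)) := by
    rw [derivative_pow]; push_cast [Nat.add_sub_cancel]; ring
  -- Subtracting the fraction n/(n + 1) of [tⁿ] Φⁿ⁺¹ leaves 1/(n + 1) of it: this is the second
  -- factor n + 1 of the square.
  have e3 : ((n + 1 : ℕ) : R) * coeff n (X * (Φ ^ n * derivative R Φ)) =
      n * coeff n (Φ ^ (n + 1)) := by
    rw [← PowerSeries.coeff_X_mul_derivative (Φ ^ (n + 1)), ← e2, ← nsmul_eq_mul,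
      ← nsmul_eq_mul, map_nsmul]
  rw [sq, mul_assoc, h1, e, map_sub, mul_sub, e3]
  push_cast
  ring

end LagrangeInversion

/-! ### The Catalan factors and powers of their inverses -/

section CatalanFactor

open PowerSeries

variable {R : Type*} [CommRing R]

/-- The power series `b` with `b = 1 - x t b²`. -/
noncomputable def catalanFactor (x : R) : R⟦X⟧ :=
  rescale (-x) (map (Nat.castRingHom R) catalanSeries)

theorem catalanFactor_eq (x : R) :
    catalanFactor x = 1 - C x * X * catalanFactor x ^ 2 := by
  have h := congrArg (fun f => rescale (-x) (map (Nat.castRingHom R) f))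
    catalanSeries_sq_mul_X_add_one
  simp only [map_add, map_mul, map_pow, map_one, map_X, rescale_X] at h
  have h' : catalanFactor x ^ 2 * (C (-x) * X) + 1 = catalanFactor x := h
  rw [map_neg] at h'
  linear_combination -h'

/-- The multiplicative inverse of `catalanFactor x`. -/
noncomputable def catalanFactorInv (x : R) : R⟦X⟧ := 1 + C x * X * catalanFactor x

theorem catalanFactorInv_mul (x : R) : catalanFactorInv x * catalanFactor x = 1 := by
  rw [catalanFactorInv]
  linear_combination catalanFactor_eq x

/-- These are the Lucas polynomials; both binomials obey Pascal's rule. The boundary case p = 2k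
needs separate care because of truncated subtraction. -/
theorem coeff_lucas (x : R) (L : ℕ → R⟦X⟧) (h1 : L 1 = 1) (h2 : L 2 = 1 + 2 * (C x * X))
    (h : ∀ p, 1 ≤ p → L (p + 2) = L (p + 1) + C x * X * L p) (p k : ℕ) (hp : 1 ≤ p) :
    coeff k (L p) = if 2 * k ≤ p then
      ((((p - k).choose k + if k = 0 then 0 else (p - k - 1).choose (k - 1) : ℕ)) : R) * x ^ k
      else 0 := by
  induction p using Nat.strong_induction_on generalizing k with
  | _ p ih =>
    obtain rfl | rfl | ⟨p, rfl, hp'⟩ : p = 1 ∨ p = 2 ∨ ∃ q, p = q + 2 ∧ 1 ≤ q := by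
      rcases p with _ | _ | _ | p
      · omega
      · simp
      · simp
      · exact Or.inr (Or.inr ⟨p + 1, rfl, by omega⟩)
    · rw [h1, coeff_one]
      rcases k with _ | k
      · simp
      · rw [if_neg (by omega), if_neg (by omega)]
    · rw [h2]
      rcases k with _ | _ | k
      · simp
      · have : (2 * (C x * X) : R⟦X⟧) = C (2 * x) * X := by
          rw [map_mul, map_ofNat]; ring
        rw [this]
        simp [coeff_one]
      · have : (2 * (C x * X) : R⟦X⟧) = C (2 * x) * X := by
          rw [map_mul, map_ofNat]; ring
        rw [this, if_neg (by omega)]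
        simp [coeff_one]
    · rw [h p hp', map_add]
      rcases k with _ | k
      · rw [ih (p + 1) (by omega) 0 (by omega)]
        simp
      · rw [mul_assoc, coeff_C_mul, coeff_succ_X_mul, ih (p + 1) (by omega) _ (by omega),
          ih p (by omega) _ hp']
        by_cases c1 : 2 * k ≤ p
        · rw [if_pos c1, if_pos (by omega : 2 * (k + 1) ≤ p + 2)]
          have hnat : (p + 2 - (k + 1)).choose (k + 1) + (p + 2 - (k + 1) - 1).choose k =
              (if 2 * (k + 1) ≤ p + 1 then
                (p + 1 - (k + 1)).choose (k + 1) + (p + 1 - (k + 1) - 1).choose k else 0) +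
              ((p - k).choose k + if k = 0 then 0 else (p - k - 1).choose (k - 1)) := by
            have a1 : (p + 2 - (k + 1)).choose (k + 1) =
                (p - k).choose k + (p - k).choose (k + 1) := by
              rw [show p + 2 - (k + 1) = (p - k) + 1 by omega, Nat.choose_succ_succ]
            have a2 : (p - k).choose k = (p - k - 1).choose k +
                if k = 0 then 0 else (p - k - 1).choose (k - 1) := by
              rcases k with _ | k
              · simp
              · rw [show p - (k + 1) = (p - (k + 1) - 1) + 1 by omega, Nat.choose_succ_succ]
                simp [add_comm]
            rw [a1, show p + 2 - (k + 1) - 1 = p - k by omega,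
              show p + 1 - (k + 1) = p - k by omega]
            split_ifs with c2 c3 c3
            · simp [c3] at a2 ⊢; omega
            · simp [c3] at a2 ⊢; omega
            · omega
            · have : p = 2 * k := by omega
              subst this
              have e : 2 * k - k = k := by omega
              have b1 : (k - 1).choose k = 0 := Nat.choose_eq_zero_of_lt (by omega)
              have b2 : k.choose (k + 1) = 0 := Nat.choose_eq_zero_of_lt (by omega)
              simp [c3, e, b1] at a2 ⊢
          have := congrArg (fun m : ℕ => (m : R) * x ^ (k + 1)) hnat
          simp only [Nat.add_sub_cancel, Nat.succ_ne_zero, if_false]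
          refine Eq.trans ?_ this.symm
          split_ifs <;> push_cast <;> ring
        · rw [if_neg c1, if_neg (by omega), if_neg (by omega)]
          simp

/-- B = b⁻¹ is a root of U² = U + x t, so the sums of p-th powers of the two roots are Lucas
polynomials. The conjugate root is divisible by t and does not affect the coefficients of degree k <
n in the power 2n. -/
theorem coeff_catalanFactorInv_pow (x : R) {n k : ℕ} (hk : k < n) :
    ((n : R) - k) * coeff k ((catalanFactorInv x ^ 2) ^ n) =
      n * (2 * n - 1 - k).choose k * x ^ k := by
  set b := catalanFactor x with hb
  set B := catalanFactorInv x with hB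
  have hBB : B ^ 2 = B + C x * X := by
    have := catalanFactorInv_mul x
    rw [← hB, ← hb] at this
    have h2 : B = 1 + C x * X * b := rfl
    linear_combination (C x * X) * this + B * h2
  set D : R⟦X⟧ := 1 - B with hD
  have hDD : D ^ 2 = D + C x * X := by rw [hD]; linear_combination hBB
  have hXD : X ∣ D := ⟨-(C x * b), by rw [hD, hB, catalanFactorInv]; ring⟩
  have hl := coeff_lucas x (fun p => B ^ p + D ^ p) (by simp [hD])
    (by simp only [hD]; linear_combination 2 * hBB)
    (fun p _ => by simp only [pow_add, hBB, hDD]; ring) (2 * n) k (by omega)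
  have hD0 : coeff k (D ^ (2 * n)) = 0 :=
    X_pow_dvd_iff.mp (pow_dvd_pow_of_dvd hXD (2 * n)) k (by omega)
  simp only [map_add, hD0, add_zero] at hl
  rw [← pow_mul, hl, if_pos (by omega)]
  obtain ⟨d, rfl⟩ : ∃ d, n = k + d + 1 := ⟨n - k - 1, by omega⟩
  have hnat : (d + 1) * ((2 * (k + d + 1) - k).choose k +
      if k = 0 then 0 else (2 * (k + d + 1) - k - 1).choose (k - 1)) =
      (k + d + 1) * (2 * (k + d + 1) - 1 - k).choose k := by
    rcases k with _ | k
    · simp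
    · have a1 : 2 * (k + 1 + d + 1) - (k + 1) = (k + 2 * d + 2) + 1 := by omega
      have a2 : 2 * (k + 1 + d + 1) - 1 - (k + 1) = k + 2 * d + 2 := by omega
      rw [a1, a2, Nat.choose_succ_succ]
      simp only [Nat.succ_ne_zero, if_false, Nat.add_sub_cancel]
      have := Nat.choose_succ_right_eq (k + 2 * d + 2) k
      rw [show k + 2 * d + 2 - k = 2 * (d + 1) by omega] at this
      nlinarith [this]
  have := congrArg (fun m : ℕ => (m : R) * x ^ k) hnat
  push_cast at this ⊢
  linear_combination this

end CatalanFactor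

/-! ### Contracting maps on power series; uniqueness for the catalytic system -/

section FixedPoint

open PowerSeries

/-- Iteration from 0 converges in the X-adic topology: coefficient n is stationary from iterate n +
1 on. -/
theorem exists_fixedPoint_of_contracting {S : Type*} [CommRing S] (f : S⟦X⟧ → S⟦X⟧)
    (hf : ∀ N s s', X ^ N ∣ s - s' → X ^ (N + 1) ∣ f s - f s') : ∃ s, f s = s := by
  set u : ℕ → S⟦X⟧ := fun n => f^[n] 0 with hu
  have hus : ∀ n, u (n + 1) = f (u n) := fun n => Function.iterate_succ_apply' f n 0
  have h1 : ∀ n, X ^ n ∣ u (n + 1) - u n := by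
    intro n
    induction n with
    | zero => simp
    | succ n ih => rw [hus (n + 1), hus n]; exact hf n _ _ (by rwa [← hus n])
  have h2 : ∀ n k, X ^ n ∣ u (n + k) - u n := by
    intro n k
    induction k with
    | zero => simp
    | succ k ih =>
      have := dvd_add ((pow_dvd_pow X (Nat.le_add_right n k)).trans (h1 (n + k))) ih
      simpa [add_assoc] using this
  set s : S⟦X⟧ := mk fun n => coeff n (u (n + 1)) with hs
  have h3 : ∀ n, X ^ n ∣ s - u n := by
    intro n
    rw [X_pow_dvd_iff]
    intro m hm
    have := X_pow_dvd_iff.mp (h2 (m + 1) (n - (m + 1))) m (by omega)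
    rw [show m + 1 + (n - (m + 1)) = n by omega, map_sub] at this
    rw [map_sub, hs, coeff_mk]
    linear_combination -this
  refine ⟨s, ?_⟩
  ext n
  have := dvd_sub (hf n _ _ (h3 n)) (h3 (n + 1))
  rw [← hus n] at this
  have := X_pow_dvd_iff.mp this n (by omega)
  simp only [map_sub] at this
  linear_combination this

theorem X_pow_dvd_of_C_mul {S : Type*} [CommRing S] [IsDomain S] {u : S} (hu : u ≠ 0) {N : ℕ}
    {f : S⟦X⟧} (h : X ^ N ∣ C u * f) : X ^ N ∣ f := by
  rw [X_pow_dvd_iff] at h ⊢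
  intro m hm
  have := h m hm
  rw [coeff_C_mul] at this
  exact (mul_eq_zero.mp this).resolve_left hu

theorem X_pow_dvd_map {S S' : Type*} [CommRing S] [CommRing S'] (g : S →+* S') {N : ℕ}
    {f : S⟦X⟧} (h : X ^ N ∣ f) : X ^ N ∣ map g f := by
  obtain ⟨k, rfl⟩ := h
  exact ⟨map g k, by simp⟩

/-- The system of functional equations with catalytic parameter `y`; the ring homomorphism `g`
plays the role of the evaluation `y = 1`. -/
structure CatalyticSystem {S : Type*} [CommRing S] (g : S →+* S) (y : S) (x : ℕ → S) (n : ℕ)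
    (Z A : S⟦X⟧) (H : ℕ → S⟦X⟧) : Prop where
  zero : H 0 = 1
  succ : ∀ j < n, C (1 - y) * (H (j + 1) - H j) = C (x j) * A * (map g (H j) - C y * H j)
  tree : A = Z * C y * H n

/-- Agreement of `A` and `A'` modulo Xᴺ passes to every H_j, since the constant 1 - y can be
cancelled coefficientwise in a domain. The factor `Z` in the last equation then improves it to Xᴺ⁺¹.
-/
theorem CatalyticSystem.unique {S : Type*} [CommRing S] [IsDomain S] {g : S →+* S} {y : S}
    (hy : 1 - y ≠ 0) {x : ℕ → S} {n : ℕ} {Z A A' : S⟦X⟧} {H H' : ℕ → S⟦X⟧} (hZ : X ∣ Z)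
    (h : CatalyticSystem g y x n Z A H) (h' : CatalyticSystem g y x n Z A' H') : A = A' := by
  have key : ∀ N, X ^ N ∣ A - A' := by
    intro N
    induction N with
    | zero => simp
    | succ N ih =>
      have hH : ∀ j ≤ n, X ^ N ∣ H j - H' j := by
        intro j
        induction j with
        | zero => intro _; simp [h.zero, h'.zero]
        | succ j ihj =>
          intro hj
          have d := ihj (by omega)
          have e : C (1 - y) * ((H (j + 1) - H' (j + 1)) - (H j - H' j)) =
              C (x j) * (map g (H j) - C y * H j) * (A - A') +
                C (x j) * A' * (map g (H j - H' j) - C y * (H j - H' j)) := by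
            rw [map_sub (map g)]
            linear_combination h.succ j (by omega) - h'.succ j (by omega)
          have d2 : X ^ N ∣ C (1 - y) * ((H (j + 1) - H' (j + 1)) - (H j - H' j)) := by
            rw [e]
            exact dvd_add (ih.mul_left _)
              ((dvd_sub (X_pow_dvd_map g d) (d.mul_left _)).mul_left _)
          have := dvd_add (X_pow_dvd_of_C_mul hy d2) d
          simpa using this
      have e : A - A' = Z * ((H n - H' n) * C y) := by
        rw [h.tree, h'.tree]; ring
      rw [e, pow_succ']
      exact mul_dvd_mul hZ ((hH n le_rfl).mul_right _)
  ext m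
  have := X_pow_dvd_iff.mp (key (m + 1)) m (by omega)
  rw [map_sub] at this
  linear_combination this

end FixedPoint

/-! ### Explicit solution of the catalytic system -/

section Solution

open PowerSeries
open scoped Polynomial

variable {R : Type*} [CommRing R]

theorem exists_prod_one_sub_eq {B : Type*} [CommRing B] (t : B) (a : ℕ → B) (n : ℕ)
    (ha : ∀ i, t ∣ a i) :
    ∃ G : B[X], ∏ i ∈ Finset.range n, (1 - Polynomial.C (a i) * Polynomial.X) =
      1 + Polynomial.C t * Polynomial.X * G := by
  induction n with
  | zero => exact ⟨0, by simp⟩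
  | succ n ih =>
    obtain ⟨G, hG⟩ := ih
    obtain ⟨c, hc⟩ := ha n
    refine ⟨G - Polynomial.C c * (1 + Polynomial.C t * Polynomial.X * G), ?_⟩
    rw [Finset.prod_range_succ, hG, hc, map_mul]
    ring

/-- The series `z(t)`. -/
noncomputable def zetaSeries (x : ℕ → R) (n : ℕ) : R⟦X⟧ :=
  X * ∏ i ∈ Finset.range n, catalanFactor (x i) ^ 2

/-- The series `t (1 - ∑ aᵢ)`, where `aᵢ = 1 - bᵢ`. -/
noncomputable def solutionSeries (x : ℕ → R) (n : ℕ) : R⟦X⟧ :=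
  X * (1 - ∑ i ∈ Finset.range n, (1 - catalanFactor (x i)))

theorem map_C_map_eval_one (f : R⟦X⟧) :
    map (Polynomial.evalRingHom (1 : R)) (map Polynomial.C f) = f := by
  ext; simp

theorem coeff_one_prod_one_sub {B : Type*} [CommRing B] (a : ℕ → B) (n : ℕ) :
    (∏ i ∈ Finset.range n, (1 - Polynomial.C (a i) * Polynomial.X)).coeff 1 =
      -∑ i ∈ Finset.range n, a i := by
  have h0 : ∀ n, (∏ i ∈ Finset.range n, (1 - Polynomial.C (a i) * Polynomial.X)).coeff 0 = 1 := by
    intro n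
    simp [Polynomial.coeff_zero_eq_eval_zero, Polynomial.eval_prod]
  induction n with
  | zero => simp [Polynomial.coeff_one]
  | succ n ih =>
    rw [Finset.prod_range_succ, mul_sub, Polynomial.coeff_sub, mul_one, ih, ← mul_assoc,
      Polynomial.coeff_mul_X, Polynomial.mul_coeff_zero, h0, Finset.sum_range_succ]
    simp
    ring

/-- The explicit solution of the catalytic system, in terms of the parameter `t`. -/
theorem exists_catalyticSystem_solution [IsDomain R] (x : ℕ → R) (n : ℕ) :
    ∃ A H, CatalyticSystem ((Polynomial.C : R →+* R[X]).comp (Polynomial.evalRingHom 1))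
      Polynomial.X (fun j => Polynomial.C (x j)) n (map Polynomial.C (zetaSeries x n)) A H ∧
      map (Polynomial.evalRingHom 1) A = solutionSeries x n := by
  set ι : R⟦X⟧ →+* R[X]⟦X⟧ := map Polynomial.C with hι
  set ev : R[X]⟦X⟧ →+* R⟦X⟧ := map (Polynomial.evalRingHom 1) with hev
  have hevι : ∀ f, ev (ι f) = f := map_C_map_eval_one
  set b : ℕ → R⟦X⟧ := fun i => catalanFactor (x i) with hb
  set a : ℕ → R⟦X⟧ := fun i => 1 - b i with ha
  -- Divisibility of a_i by t makes s ↦ 1 - y Q(s) a contraction.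
  have hab : ∀ i, a i = X * (C (x i) * b i ^ 2) := by
    intro i
    simp only [ha, hb]
    linear_combination -catalanFactor_eq (x i)
  obtain ⟨G, hG⟩ := exists_prod_one_sub_eq X a n (fun i => ⟨_, hab i⟩)
  set Q := ∏ i ∈ Finset.range n, (1 - Polynomial.C (a i) * Polynomial.X) with hQ
  have hQ0 : Q.coeff 0 = 1 := by rw [hG]; simp
  have hK := fun j => X_mul_kernelPoly_succ a hQ0 j
  have hKn := X_mul_kernelPoly a n hQ
  set K := kernelPoly a Q with hKdef
  set y : R[X]⟦X⟧ := C Polynomial.X with hy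
  set E : R[X]⟦X⟧ → R⟦X⟧[X] →+* R[X]⟦X⟧ := fun s => Polynomial.eval₂RingHom ι s with hE
  have hEX : ∀ s, E s Polynomial.X = s := fun s => by simp [hE]
  have hEC : ∀ s c, E s (Polynomial.C c) = ι c := fun s c => by simp [hE]
  have hEsub : ∀ s s' p, s - s' ∣ E s p - E s' p := by
    intro s s' p
    simpa [hE, Polynomial.eval₂_eq_eval_map] using Polynomial.sub_dvd_eval_sub s s' (p.map ι)
  have hιX : ι X = X := by simp [hι]
  obtain ⟨s, hs⟩ := exists_fixedPoint_of_contracting (fun s => 1 - y * E s Q) (by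
    intro N s s' h
    have e : (1 - y * E s Q) - (1 - y * E s' Q) =
        X * (-y * (E s (Polynomial.X * G) - E s' (Polynomial.X * G))) := by
      rw [hG, mul_assoc]
      simp only [map_add, map_one, map_mul (E _) (Polynomial.C X), hEC, hιX]
      ring
    simp only [e, pow_succ']
    exact mul_dvd_mul dvd_rfl ((h.trans (hEsub s s' _)).mul_left _))
  -- At y = 1 the equation for s reads s (1 + t G(s)) = 0, and the second factor is a unit.
  have hevs : ev s = 0 := by
    have h1 := congrArg ev hs
    rw [hG] at h1
    simp only [map_add, map_one, map_mul, hEC, hEX, hιX, map_sub] at h1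
    have h2 : ev y = 1 := by simp [hev, hy]
    have h3 : ev X = X := by simp [hev]
    rw [h2, h3] at h1
    have h4 : ev s * (1 + X * ev (E s G)) = 0 := by linear_combination -h1
    have h5 : IsUnit (1 + X * ev (E s G)) := by
      rw [isUnit_iff_constantCoeff]; simp
    exact h5.mul_left_eq_zero.mp h4
  -- Hence H_j at y = 1 involves K_j(0), which is why that constant appears in the kernel recursion.
  have hevE : ∀ p, ev (E s p) = p.coeff 0 := by
    intro p
    have : ev.comp (E s) = Polynomial.constantCoeff := by
      ext1
      · ext1 c
        simp only [RingHom.comp_apply, hEC, hevι]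
        simp
      · simp only [RingHom.comp_apply, hEX, hevs]
        simp
    exact congrArg (fun f : R⟦X⟧[X] →+* R⟦X⟧ => f p) this
  have hsne : s ≠ 0 := by
    rintro rfl
    have h1 := congrArg (constantCoeff (R := R[X])) hs
    rw [hG] at h1
    simp only [map_add, map_one, map_mul, hEC, hEX, hιX, map_sub, map_zero] at h1
    have : constantCoeff y = (Polynomial.X : R[X]) := by simp [hy]
    rw [this] at h1
    have h2 := congrArg (Polynomial.coeff · 1) h1
    simp [Polynomial.coeff_one] at h2
  set q : R⟦X⟧[X] := 1 + Polynomial.C X * G with hq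
  have hXq : Polynomial.X * q = Q - 1 + Polynomial.X := by rw [hq, hG]; ring
  have hsq : s * E s q = E s Q - 1 + s := by
    have := congrArg (E s) hXq
    simpa [hEX] using this
  have hQunit : E s Q ≠ 0 := by
    intro h0
    have := hevE Q
    rw [h0, hQ0, map_zero] at this
    exact zero_ne_one this
  set Bi : ℕ → R⟦X⟧ := fun i => catalanFactorInv (x i) with hBi
  have hBb : ∀ i, Bi i * b i = 1 := fun i => catalanFactorInv_mul (x i)
  set Pi : ℕ → R⟦X⟧ := fun j => ∏ i ∈ Finset.range j, Bi i ^ 2 with hPi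
  -- Here y = (1 - s)/Q(s) and 1 - y = s q(s)/Q(s). With this A the factor q(s) cancels from the
  -- j-th equation, and x_j t = a_j / b_j² turns it into the recursion for K_j evaluated at s.
  refine ⟨X * (1 - s) * E s q, fun j => ι (Pi j) * E s (K j), ⟨?_, ?_, ?_⟩, ?_⟩
  · simp [hPi, hKdef, kernelPoly]
  · intro j hj
    have hmap : ∀ f, map ((Polynomial.C : R →+* R[X]).comp (Polynomial.evalRingHom 1)) f =
        ι (ev f) := fun f => by ext; simp [hι, hev]
    rw [hmap, map_mul, hevι, hevE]
    have hP1 : Pi (j + 1) = Pi j * Bi j ^ 2 := Finset.prod_range_succ _ _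
    have hKs := congrArg (E s) (hK j)
    simp only [map_mul, map_add, map_sub, map_one, hEX, hEC] at hKs
    have hx : C (Polynomial.C (x j)) * X = ι (a j) * ι (Bi j) ^ 2 := by
      rw [← map_pow, ← map_mul, hab]
      have : X * (C (x j) * b j ^ 2) * Bi j ^ 2 = C (x j) * X := by
        linear_combination (C (x j) * X * (Bi j * b j + 1)) * hBb j
      rw [this]
      simp [hι]
    have hBa : ι (Bi j) ^ 2 * (1 - ι (a j)) ^ 2 = 1 := by
      have : (Bi j) ^ 2 * (1 - a j) ^ 2 = 1 := by
        simp only [ha, sub_sub_cancel]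
        rw [← mul_pow, hBb, one_pow]
      have := congrArg ι this
      simpa using this
    apply mul_left_cancel₀ hQunit
    rw [hP1]
    have hyQ : y * E s Q = 1 - s := by linear_combination -hs
    have hyQ' : (1 - y) * E s Q = s * E s q := by linear_combination -hsq - hyQ
    have hC1 : (C (1 - Polynomial.X) : R[X]⟦X⟧) = 1 - y := by simp [hy]
    rw [hC1, ← hy]
    simp only [map_mul, map_pow]
    linear_combination (ι (Pi j) * ι (Bi j) ^ 2 * E s (K (j + 1)) - ι (Pi j) * E s (K j)) * hyQ'
      + E s q * ι (Pi j) * ι (Bi j) ^ 2 * hKs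
      + (C (Polynomial.C (x j)) * X * (1 - s) * E s q * ι (Pi j) * E s (K j)) * hyQ
      - (1 - s) * E s q * ι (Pi j) * (E s Q * ι ((K j).coeff 0) - (1 - s) * E s (K j)) * hx
      + E s q * ι (Pi j) * E s (K j) * s * hBa
  · have hyQ : y * E s Q = 1 - s := by linear_combination -hs
    have hz : ι (zetaSeries x n) * ι (Pi n) = X := by
      rw [← map_mul, zetaSeries, hPi, mul_assoc, ← Finset.prod_mul_distrib,
        Finset.prod_eq_one, mul_one, hιX]
      intro i _
      rw [← mul_pow, mul_comm, hBb, one_pow]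
    have hKn' := congrArg (E s) hKn
    simp only [map_mul, map_add, map_sub, map_one, hEX] at hKn'
    rw [← hsq] at hKn'
    -- The closing identity evaluated at s; the common factor s is nonzero because s = 0 would force
    -- y = 1.
    have hKn'' : E s (K n) = E s Q * E s q := by
      apply mul_left_cancel₀ hsne
      linear_combination hKn'
    rw [← hy, hKn'']
    linear_combination (-(X * E s q)) * hyQ - (y * E s Q * E s q) * hz
  · have hXe : ev X = X := by simp [hev]
    have hq0 : q.coeff 0 = 1 - ∑ i ∈ Finset.range n, a i := by
      have h1 := congrArg (Polynomial.coeff · 1) hXq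
      have h2 := coeff_one_prod_one_sub a n
      rw [← hQ] at h2
      simp only [Polynomial.coeff_add, Polynomial.coeff_sub, Polynomial.coeff_X_mul,
        Polynomial.coeff_X_one, Polynomial.coeff_one, h2] at h1
      rw [h1]
      simp
      ring
    rw [map_mul, map_mul, map_sub, map_one, hevs, hevE, hXe, hq0, solutionSeries]
    simp [ha, hb]

/-- Differentiating b = 1 - x t b² gives 2 t b'/b = t b' - (1 - b). Thus the logarithmic derivative
of ∏ b_i² is a sum matching the derivative of t (1 - ∑ a_i). -/
theorem derivative_solutionSeries (x : ℕ → R) (n : ℕ) :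
    derivative R (zetaSeries x n) =
      (∏ i ∈ Finset.range n, catalanFactor (x i) ^ 2) * derivative R (solutionSeries x n) := by
  have hb : ∀ r : R, 2 * X * derivative R (catalanFactor r) =
      catalanFactor r * (X * derivative R (catalanFactor r) - (1 - catalanFactor r)) := by
    intro r
    have h1 := catalanFactor_eq r
    have h2 := congrArg (derivative R) h1
    simp only [map_sub, Derivation.leibniz, derivative_X, derivative_one, derivative_C,
      derivative_pow, smul_eq_mul] at h2
    set b := catalanFactor r
    simp only [Nat.add_one_sub_one, pow_one, Nat.cast_ofNat] at h2
    linear_combination (X * b) * h2 - (b + 2 * X * derivative R b) * h1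
  have hprod : X * derivative R (∏ i ∈ Finset.range n, catalanFactor (x i) ^ 2) =
      (∏ i ∈ Finset.range n, catalanFactor (x i) ^ 2) *
        ∑ i ∈ Finset.range n, (X * derivative R (catalanFactor (x i)) -
          (1 - catalanFactor (x i))) := by
    induction n with
    | zero => simp
    | succ n ih =>
      rw [Finset.prod_range_succ, Finset.sum_range_succ, Derivation.leibniz, derivative_pow]
      simp only [smul_eq_mul, Nat.add_one_sub_one, pow_one, Nat.cast_ofNat]
      linear_combination catalanFactor (x n) ^ 2 * ih +
        (∏ i ∈ Finset.range n, catalanFactor (x i) ^ 2) * catalanFactor (x n) * hb (x n)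
  rw [zetaSeries, solutionSeries, Derivation.leibniz, Derivation.leibniz]
  simp only [smul_eq_mul, derivative_X, map_sub, derivative_one, map_sum, zero_sub]
  rw [Finset.sum_sub_distrib, ← Finset.mul_sum] at hprod
  simp only [Finset.sum_neg_distrib]
  linear_combination hprod

/-- The catalytic system determines the coefficients of the series `A` at `y = 1`. -/
theorem sq_mul_coeff_of_catalyticSystem [IsDomain R] [CharZero R] {x : ℕ → R} {n : ℕ}
    {A : R[X]⟦X⟧} {H : ℕ → R[X]⟦X⟧}
    (h : CatalyticSystem ((Polynomial.C : R →+* R[X]).comp (Polynomial.evalRingHom 1))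
      Polynomial.X (fun j => Polynomial.C (x j)) n X A H) (m : ℕ) :
    ((m + 1 : ℕ) : R) ^ 2 * (coeff (m + 1) A).eval 1 =
      coeff m ((∏ i ∈ Finset.range n, catalanFactorInv (x i) ^ 2) ^ (m + 1)) := by
  have h0 : constantCoeff (zetaSeries x n) = 0 := by simp [zetaSeries]
  have hζΦ : zetaSeries x n * ∏ i ∈ Finset.range n, catalanFactorInv (x i) ^ 2 = X := by
    rw [zetaSeries, mul_assoc, ← Finset.prod_mul_distrib, Finset.prod_eq_one, mul_one]
    intro i _
    rw [← mul_pow, mul_comm, catalanFactorInv_mul, one_pow]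
  set ζ' : R[X]⟦X⟧ := map Polynomial.C (zetaSeries x n) with hζ'
  have h0' : constantCoeff ζ' = 0 := by simp [hζ', zetaSeries]
  have hs : HasSubst (zetaSeries x n) := HasSubst.of_constantCoeff_zero' h0
  have hs' : HasSubst ζ' := HasSubst.of_constantCoeff_zero' h0'
  obtain ⟨A₁, H₁, hsys, hA₁⟩ := exists_catalyticSystem_solution x n
  -- Substituting z = z(t) turns the system in z into the one already solved in t. Evaluation at y =
  -- 1 commutes with it because the coefficients of z(t) are free of y.
  have hsub : CatalyticSystem ((Polynomial.C : R →+* R[X]).comp (Polynomial.evalRingHom 1))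
      Polynomial.X (fun j => Polynomial.C (x j)) n ζ' (A.subst ζ') (fun j => (H j).subst ζ') := by
    have hC : ∀ r : R[X], (C r : R[X]⟦X⟧).subst ζ' = C r := fun r => subst_C r
    refine ⟨?_, ?_, ?_⟩
    · have := hC 1
      simp only [map_one] at this
      simp only [h.zero, this]
    · intro j hj
      have e := congrArg (fun f : R[X]⟦X⟧ => (f.subst ζ' : R[X]⟦X⟧)) (h.succ j hj)
      simp only [subst_mul hs', subst_sub hs', hC] at e
      rw [e]
      congr 2
      have := map_subst hs' (h := (Polynomial.C : R →+* R[X]).comp (Polynomial.evalRingHom 1))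
        (H j)
      have hfix : map ((Polynomial.C : R →+* R[X]).comp (Polynomial.evalRingHom 1)) ζ' = ζ' := by
        ext; simp [hζ']
      refine Eq.trans ?_ this.symm
      rw [show MvPowerSeries.map ((Polynomial.C : R →+* R[X]).comp (Polynomial.evalRingHom 1)) ζ' =
        ζ' from hfix]
    · have e := congrArg (fun f : R[X]⟦X⟧ => (f.subst ζ' : R[X]⟦X⟧)) h.tree
      simp only [subst_mul hs', subst_X hs', hC] at e
      exact e
  have hy : (1 - Polynomial.X : R[X]) ≠ 0 := by
    intro h
    have := congrArg (Polynomial.coeff · 0) h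
    simp at this
  have hXζ : X ∣ ζ' := X_dvd_iff.mpr h0'
  have hA := hsub.unique hy hXζ hsys
  have hF : (map (Polynomial.evalRingHom 1) A).subst (zetaSeries x n) = solutionSeries x n := by
    rw [← hA₁, ← hA]
    have := map_subst hs' (h := Polynomial.evalRingHom (1 : R)) A
    refine Eq.trans ?_ this.symm
    rw [show MvPowerSeries.map (Polynomial.evalRingHom (1 : R)) ζ' = zetaSeries x n from
      map_C_map_eval_one _]
  have := sq_mul_coeff_of_derivative_subst_eq (F := map (Polynomial.evalRingHom 1) A) h0 hζΦ (by
    rw [hF, derivative_solutionSeries]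
    have : (∏ i ∈ Finset.range n, catalanFactor (x i) ^ 2) *
        (∏ i ∈ Finset.range n, catalanFactorInv (x i) ^ 2) = 1 := by
      rw [← Finset.prod_mul_distrib, Finset.prod_eq_one]
      intro i _
      rw [← mul_pow, mul_comm, catalanFactorInv_mul, one_pow]
    linear_combination (-derivative R (solutionSeries x n)) * this) m
  rw [← this]
  simp

end Solution

/-! ### Stack-sorting, relabelling, 231-avoidance and cut letters -/

section Words

theorem le_maxLetter {a : ℕ} {w : List ℕ} (h : a ∈ w) : a ≤ maxLetter w := by
  induction w with
  | nil => simp at h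
  | cons b w ih =>
    change a ≤ max b (maxLetter w)
    rcases List.mem_cons.mp h with rfl | h
    · exact le_max_left _ _
    · exact (ih h).trans (le_max_right _ _)

theorem maxLetter_eq {m : ℕ} {w : List ℕ} (h : m ∈ w) (h' : ∀ a ∈ w, a ≤ m) :
    maxLetter w = m :=
  le_antisymm (h' _ (maxLetter_mem (List.ne_nil_of_mem h))) (le_maxLetter h)

theorem maxLetter_map {f : ℕ → ℕ} {w : List ℕ} (hw : w ≠ [])
    (hf : StrictMonoOn f {a | a ∈ w}) : maxLetter (w.map f) = f (maxLetter w) := by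
  apply maxLetter_eq
  · exact List.mem_map_of_mem (maxLetter_mem hw)
  · intro a ha
    obtain ⟨b, hb, rfl⟩ := List.mem_map.mp ha
    exact hf.monotoneOn hb (maxLetter_mem hw) (le_maxLetter hb)

theorem splitOn_cons (m a : ℕ) (w : List ℕ) :
    (a :: w).splitOn m = if a = m then [] :: w.splitOn m else
      (w.splitOn m).modifyHead (List.cons a) := by
  simp [List.splitOn, List.splitOnP_cons_eq_if_modifyHead]

theorem splitOn_map {f : ℕ → ℕ} {m : ℕ} {w : List ℕ} (hf : ∀ a ∈ w, f a = f m → a = m) :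
    (w.map f).splitOn (f m) = (w.splitOn m).map (List.map f) := by
  induction w with
  | nil => simp
  | cons a w ih =>
    have ih' := ih fun b hb => hf b (List.mem_cons_of_mem _ hb)
    rw [List.map_cons, splitOn_cons, splitOn_cons, ih']
    have h : f a = f m ↔ a = m := ⟨hf a List.mem_cons_self, fun h => h ▸ rfl⟩
    simp only [h]
    split_ifs
    · simp
    · cases w.splitOn m <;> simp

theorem notMem_of_mem_splitOn {m : ℕ} {w u : List ℕ} (hu : u ∈ w.splitOn m) : m ∉ u := by
  induction w generalizing u with
  | nil => simp_all
  | cons a w ih =>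
    rw [splitOn_cons] at hu
    split_ifs at hu with h
    · rcases List.mem_cons.mp hu with rfl | hu
      · simp
      · exact ih hu
    · rcases hs : w.splitOn m with _ | ⟨x, l⟩
      · simp [hs] at hu
      · rw [hs] at hu ih
        simp only [List.modifyHead_cons, List.mem_cons] at hu
        rcases hu with rfl | hu
        · simp [ih (u := x) (by simp), Ne.symm h]
        · exact ih (by simp [hu])

theorem mem_intercalate {m a : ℕ} (ham : a ≠ m) (f : List (List ℕ)) :
    a ∈ [m].intercalate f ↔ a ∈ f.flatten := by
  induction f with
  | nil => simp
  | cons α f ih =>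
    rcases f with _ | ⟨β, f⟩
    · simp [List.intercalate_singleton]
    · rw [List.intercalate_cons_cons]
      simp only [List.mem_append, List.mem_singleton, ham, ih, or_false]
      simp

theorem mem_splitOn_flatten {m a : ℕ} (ham : a ≠ m) (w : List ℕ) :
    a ∈ (w.splitOn m).flatten ↔ a ∈ w := by
  rw [← mem_intercalate ham, List.intercalate_splitOn]

theorem mem_of_mem_splitOn {m a : ℕ} {w u : List ℕ} (hu : u ∈ w.splitOn m) (ha : a ∈ u) :
    a ∈ w := by
  have ham : a ≠ m := fun h => notMem_of_mem_splitOn hu (h ▸ ha)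
  exact (mem_splitOn_flatten ham w).mp (List.mem_flatten.mpr ⟨u, hu, ha⟩)

/-- Induction along the recursion of `stackSort`. -/
theorem stackSort_induction {motive : List ℕ → Prop} (nil : motive [])
    (step : ∀ w ≠ [], (∀ u ∈ w.splitOn (maxLetter w), motive u) → motive w) (w : List ℕ) :
    motive w := by
  induction hn : w.length using Nat.strong_induction_on generalizing w with
  | _ n ih =>
    subst hn
    by_cases hw : w = []
    · exact hw ▸ nil
    · exact step w hw fun u hu => ih _ (length_lt_of_mem_splitOn (maxLetter_mem hw) hu) u rfl

theorem mem_stackSort {a : ℕ} (w : List ℕ) : a ∈ stackSort w ↔ a ∈ w := by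
  induction w using stackSort_induction with
  | nil => simp [stackSort_nil]
  | step w hw ih =>
    rw [stackSort_of_ne_nil hw]
    by_cases ha : a = maxLetter w
    · subst ha
      simp [maxLetter_mem hw]
    · rw [← mem_splitOn_flatten ha w]
      simp only [List.mem_append, List.mem_flatten, List.mem_map, List.mem_singleton, ha, or_false]
      constructor
      · rintro ⟨_, ⟨u, hu, rfl⟩, h⟩
        exact ⟨u, hu, (ih u hu).mp h⟩
      · rintro ⟨u, hu, h⟩
        exact ⟨_, ⟨u, hu, rfl⟩, (ih u hu).mpr h⟩

theorem stackSort_map {f : ℕ → ℕ} {w : List ℕ} (hf : StrictMonoOn f {a | a ∈ w}) :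
    stackSort (w.map f) = (stackSort w).map f := by
  induction w using stackSort_induction with
  | nil => simp [stackSort_nil]
  | step w hw ih =>
    rw [stackSort_of_ne_nil hw, stackSort_of_ne_nil (by simpa using hw), maxLetter_map hw hf,
      splitOn_map fun a ha h => hf.injOn ha (maxLetter_mem hw) h, List.map_append,
      List.map_flatten, List.map_map, List.map_map]
    congr 2
    apply List.map_congr_left
    intro u hu
    exact ih u hu (hf.mono fun a ha => mem_of_mem_splitOn hu ha)

/-- The postorder word of a list of words. -/
def forestSort (f : List (List ℕ)) : List ℕ := (f.map stackSort).flatten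

@[simp] theorem forestSort_nil : forestSort [] = [] := rfl

@[simp] theorem forestSort_cons (α : List ℕ) (f : List (List ℕ)) :
    forestSort (α :: f) = stackSort α ++ forestSort f := by simp [forestSort]

theorem mem_forestSort {a : ℕ} (f : List (List ℕ)) : a ∈ forestSort f ↔ a ∈ f.flatten := by
  simp [forestSort, mem_stackSort]

theorem forestSort_map {g : ℕ → ℕ} {f : List (List ℕ)} (hg : StrictMonoOn g {a | a ∈ f.flatten}) :
    forestSort (f.map (List.map g)) = (forestSort f).map g := by
  induction f with
  | nil => rfl
  | cons α f ih =>
    rw [List.map_cons, forestSort_cons, forestSort_cons, List.map_append,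
      stackSort_map (hg.mono fun a ha => by simp_all), ih (hg.mono fun a ha => by simp_all)]

/-- Length at least two ensures that the separator `M` occurs, so that it is the maximum. -/
theorem stackSort_intercalate {M : ℕ} {f : List (List ℕ)} (hf : 2 ≤ f.length)
    (hM : ∀ a ∈ f.flatten, a < M) : stackSort ([M].intercalate f) = forestSort f ++ [M] := by
  obtain ⟨α, β, g, rfl⟩ : ∃ α β g, f = α :: β :: g := by
    rcases f with _ | ⟨α, _ | ⟨β, g⟩⟩
    · simp at hf
    · simp at hf
    · exact ⟨α, β, g, rfl⟩
  set f := α :: β :: g with hfdef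
  have hmem : M ∈ [M].intercalate f := by simp [hfdef, List.intercalate_cons_cons]
  have hmax : maxLetter ([M].intercalate f) = M := by
    apply maxLetter_eq hmem
    intro a ha
    by_cases h : a = M
    · exact h.le
    · exact (hM a ((mem_intercalate h f).mp ha)).le
  rw [stackSort_of_ne_nil (List.ne_nil_of_mem hmem), hmax, List.splitOn_intercalate _ _ (by simp [hfdef])]
  · rfl
  · intro l hl h
    exact (hM M (List.mem_flatten.mpr ⟨l, hl, h⟩)).false

/-- The word `v` avoids the pattern `231`. -/
def Avoids231 (v : List ℕ) : Prop := ∀ a b c, a < b → b < c → ¬ [b, c, a].Sublist v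

theorem Avoids231.sublist {u v : List ℕ} (h : Avoids231 v) (huv : u.Sublist v) : Avoids231 u :=
  fun a b c hab hbc hs => h a b c hab hbc (hs.trans huv)

theorem sublist_map_iff_of_injOn {g : ℕ → ℕ} {l v : List ℕ} (hg : Set.InjOn g {a | a ∈ v})
    (hl : ∀ a ∈ l, a ∈ v) : (l.map g).Sublist (v.map g) ↔ l.Sublist v := by
  refine ⟨fun h => ?_, fun h => h.map g⟩
  obtain ⟨l', hl', e⟩ := List.sublist_map_iff.mp h
  have : l = l' := by
    have hinj : ∀ (l l' : List ℕ), (∀ a ∈ l, a ∈ v) → (∀ a ∈ l', a ∈ v) →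
        l.map g = l'.map g → l = l' := by
      intro l
      induction l with
      | nil => intro l' _ _ h; simpa using h.symm
      | cons a l ih =>
        intro l' h1 h2 h
        rcases l' with _ | ⟨b, l'⟩
        · simp at h
        · simp only [List.map_cons, List.cons.injEq] at h
          rw [hg (h1 a (by simp)) (h2 b (by simp)) h.1, ih l' (fun c hc => h1 c (by simp [hc]))
            (fun c hc => h2 c (by simp [hc])) h.2]
    exact hinj l l' hl (fun a ha => hl'.subset ha) e
  exact this ▸ hl'

theorem avoids231_map {g : ℕ → ℕ} {v : List ℕ} (hg : StrictMonoOn g {a | a ∈ v}) :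
    Avoids231 (v.map g) ↔ Avoids231 v := by
  constructor
  · intro h a b c hab hbc hs
    have ha : a ∈ v := hs.subset (by simp)
    have hb : b ∈ v := hs.subset (by simp)
    have hc : c ∈ v := hs.subset (by simp)
    exact h (g a) (g b) (g c) (hg ha hb hab) (hg hb hc hbc) (hs.map g)
  · intro h a b c hab hbc hs
    have hmem : ∀ x ∈ [b, c, a], ∃ y ∈ v, g y = x := fun x hx =>
      List.mem_map.mp (hs.subset hx)
    obtain ⟨a, ha, rfl⟩ := hmem a (by simp)
    obtain ⟨b, hb, rfl⟩ := hmem b (by simp)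
    obtain ⟨c, hc, rfl⟩ := hmem c (by simp)
    refine h a b c ((hg.lt_iff_lt ha hb).mp hab) ((hg.lt_iff_lt hb hc).mp hbc) ?_
    rw [← sublist_map_iff_of_injOn hg.injOn (by simp [ha, hb, hc])]
    exact hs

/-- The letters `b` of `v` such that the letters at most `b` precede the larger ones. -/
noncomputable def cutLetters (v : List ℕ) : Finset ℕ :=
  open Classical in
  v.toFinset.filter fun b => ∀ a c, a ≤ b → b < c → ¬ [c, a].Sublist v

theorem mem_cutLetters {v : List ℕ} {b : ℕ} :
    b ∈ cutLetters v ↔ b ∈ v ∧ ∀ a c, a ≤ b → b < c → ¬ [c, a].Sublist v := by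
  simp [cutLetters]

theorem cutLetters_map {g : ℕ → ℕ} {v : List ℕ} (hg : StrictMonoOn g {a | a ∈ v}) :
    cutLetters (v.map g) = (cutLetters v).image g := by
  ext b'
  simp only [mem_cutLetters, Finset.mem_image, List.mem_map]
  constructor
  · rintro ⟨⟨b, hb, rfl⟩, h⟩
    refine ⟨b, ⟨hb, fun a c hab hbc hs => ?_⟩, rfl⟩
    have ha : a ∈ v := hs.subset (by simp)
    have hc : c ∈ v := hs.subset (by simp)
    exact h (g a) (g c) (hg.monotoneOn ha hb hab) (hg hb hc hbc) (hs.map g)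
  · rintro ⟨b, ⟨hb, h⟩, rfl⟩
    refine ⟨⟨b, hb, rfl⟩, fun a c hab hbc hs => ?_⟩
    have hmem : ∀ x ∈ [c, a], ∃ y ∈ v, g y = x := fun x hx => List.mem_map.mp (hs.subset hx)
    obtain ⟨a, ha, rfl⟩ := hmem a (by simp)
    obtain ⟨c, hc, rfl⟩ := hmem c (by simp)
    refine h a c ((hg.le_iff_le ha hb).mp hab) ((hg.lt_iff_lt hb hc).mp hbc) ?_
    rw [← sublist_map_iff_of_injOn hg.injOn (by simp [ha, hc])]
    exact hs

end Words

/-! ### Knuth's criterion for one pass of the stack -/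

section Patterns

theorem pair_sublist_append {c a : ℕ} {u v : List ℕ} :
    [c, a].Sublist (u ++ v) ↔ [c, a].Sublist u ∨ (c ∈ u ∧ a ∈ v) ∨ [c, a].Sublist v := by
  constructor
  · intro h
    obtain ⟨l₁, l₂, e, h1, h2⟩ := List.sublist_append_iff.mp h
    rcases l₁ with _ | ⟨x, _ | ⟨y, l₁⟩⟩
    · simp at e; subst e; exact Or.inr (Or.inr h2)
    · simp at e; obtain ⟨rfl, rfl⟩ := e
      exact Or.inr (Or.inl ⟨h1.subset (by simp), h2.subset (by simp)⟩)
    · simp at e; obtain ⟨rfl, rfl, rfl, rfl⟩ := e; exact Or.inl h1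
  · rintro (h | ⟨h1, h2⟩ | h)
    · exact h.trans (List.sublist_append_left u v)
    · exact (List.singleton_sublist.mpr h1).append (List.singleton_sublist.mpr h2)
    · exact h.trans (List.sublist_append_right u v)

theorem triple_sublist_append {b c a : ℕ} {u v : List ℕ} :
    [b, c, a].Sublist (u ++ v) ↔ [b, c, a].Sublist u ∨ ([b, c].Sublist u ∧ a ∈ v) ∨
      (b ∈ u ∧ [c, a].Sublist v) ∨ [b, c, a].Sublist v := by
  constructor
  · intro h
    obtain ⟨l₁, l₂, e, h1, h2⟩ := List.sublist_append_iff.mp h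
    rcases l₁ with _ | ⟨x, _ | ⟨y, _ | ⟨z, l₁⟩⟩⟩
    · simp at e; subst e; exact Or.inr (Or.inr (Or.inr h2))
    · simp at e; obtain ⟨rfl, rfl⟩ := e
      exact Or.inr (Or.inr (Or.inl ⟨h1.subset (by simp), h2⟩))
    · simp at e; obtain ⟨rfl, rfl, rfl⟩ := e
      exact Or.inr (Or.inl ⟨h1, h2.subset (by simp)⟩)
    · simp at e; obtain ⟨rfl, rfl, rfl, rfl, rfl⟩ := e; exact Or.inl h1
  · rintro (h | ⟨h1, h2⟩ | ⟨h1, h2⟩ | h)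
    · exact h.trans (List.sublist_append_left u v)
    · exact h1.append (List.singleton_sublist.mpr h2)
    · exact (List.singleton_sublist.mpr h1).append h2
    · exact h.trans (List.sublist_append_right u v)

theorem pair_sublist_of_mem {c m : ℕ} {u v : List ℕ} (h : c ∈ u) : [c, m].Sublist (u ++ m :: v) :=
  pair_sublist_append.mpr (Or.inr (Or.inl ⟨h, by simp⟩))

/-- A letter of `L`, then `m`, then a smaller letter of `R` is a 231; once `L` lies below `R`, no
occurrence can straddle the two sides. -/
theorem avoids231_append_max {L R : List ℕ} {m : ℕ} (hL : ∀ x ∈ L, x < m) (hR : ∀ x ∈ R, x < m)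
    (hd : List.Disjoint L R) :
    Avoids231 (L ++ m :: R) ↔ Avoids231 L ∧ Avoids231 R ∧ ∀ x ∈ L, ∀ y ∈ R, x < y := by
  constructor
  · intro h
    refine ⟨h.sublist (List.sublist_append_left _ _),
      h.sublist ((List.sublist_cons_self m R).trans (List.sublist_append_right _ _)), ?_⟩
    intro x hx y hy
    by_contra hxy
    have hne : x ≠ y := fun e => hd hx (e ▸ hy)
    refine h y x m (by omega) (hL x hx) ?_
    exact triple_sublist_append.mpr (Or.inr (Or.inr (Or.inl
      ⟨hx, (List.singleton_sublist.mpr hy).cons_cons m⟩)))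
  · rintro ⟨h1, h2, h3⟩ a b c hab hbc hs
    have hm : ∀ x ∈ m :: R, x ≤ m := by
      intro x hx
      rcases List.mem_cons.mp hx with rfl | hx
      · exact le_rfl
      · exact (hR x hx).le
    rcases triple_sublist_append.mp hs with h | ⟨h, ha⟩ | ⟨hb, h⟩ | h
    · exact h1 a b c hab hbc h
    · have hb := hL b (h.subset (by simp))
      rcases List.mem_cons.mp ha with rfl | ha
      · omega
      · have := h3 b (h.subset (by simp)) a ha
        omega
    · have ha : a ∈ m :: R := h.subset (by simp)
      have hb' := hL b hb
      rcases List.mem_cons.mp ha with rfl | ha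
      · omega
      · have := h3 b hb a ha
        omega
    · cases h with
      | cons _ h => exact h2 a b c hab hbc h
      | cons_cons _ h =>
        have := hm c (List.mem_cons_of_mem _ (h.subset (by simp)))
        omega

/-- For v = L m R both sides obey the same recursion: S(L) S(R) m is increasing iff S(L) and S(R)
are and `L` lies below `R`. -/
theorem pairwise_stackSort_iff {v : List ℕ} (hv : v.Nodup) :
    (stackSort v).Pairwise (· < ·) ↔ Avoids231 v := by
  induction v using stackSort_induction with
  | nil =>
    simp only [stackSort_nil, List.Pairwise.nil, true_iff]
    intro a b c _ _ h
    simp at h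
  | step v hne ih =>
    obtain ⟨L, R, e⟩ := List.append_of_mem (maxLetter_mem hne)
    set m := maxLetter v with hm
    rw [e] at hv
    have hv' := List.nodup_append.mp hv
    have hmL : m ∉ L := fun h => hv'.2.2 m h m (by simp) rfl
    have hmR : m ∉ R := (List.nodup_cons.mp hv'.2.1).1
    have hsplit : v.splitOn m = [L, R] := by
      have := List.splitOn_intercalate (ls := [L, R]) m (by simp [hmL, hmR]) (by simp)
      rw [List.intercalate_cons_cons, List.intercalate_singleton] at this
      rw [e, ← this]
      simp
    have hLm : ∀ x ∈ L, x < m := fun x hx =>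
      lt_of_le_of_ne (le_maxLetter (e ▸ by simp [hx])) fun h => hmL (h ▸ hx)
    have hRm : ∀ x ∈ R, x < m := fun x hx =>
      lt_of_le_of_ne (le_maxLetter (e ▸ by simp [hx])) fun h => hmR (h ▸ hx)
    have hd : List.Disjoint L R := fun x hx hy => hv'.2.2 x hx x (by simp [hy]) rfl
    have ihL := ih L (by simp [hsplit]) hv'.1
    have ihR := ih R (by simp [hsplit]) (List.nodup_cons.mp hv'.2.1).2
    rw [stackSort_of_ne_nil hne, ← hm, hsplit, e, avoids231_append_max hLm hRm hd, ← ihL, ← ihR]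
    simp only [List.map_cons, List.map_nil, List.flatten_cons, List.flatten_nil, List.append_nil,
      List.pairwise_append, mem_stackSort, List.mem_append, List.mem_singleton,
      List.pairwise_singleton]
    constructor
    · rintro ⟨⟨h1, h2, h3⟩, _⟩
      exact ⟨h1, h2, h3⟩
    · rintro ⟨h1, h2, h3⟩
      refine ⟨⟨h1, h2, h3⟩, trivial, ?_⟩
      rintro a (ha | ha) b rfl
      · exact hLm a ha
      · exact hRm a ha

theorem avoids231_append_singleton_max {v : List ℕ} {M : ℕ} (hM : ∀ a ∈ v, a < M) :
    Avoids231 (v ++ [M]) ↔ Avoids231 v := by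
  rw [avoids231_append_max hM (by simp) (by simp)]
  constructor
  · exact fun h => h.1
  · refine fun h => ⟨h, ?_, by simp⟩
    intro a b c _ _ hs
    simp at hs

theorem cutLetters_append_singleton_max {v : List ℕ} {M : ℕ} (hM : ∀ a ∈ v, a < M) :
    cutLetters (v ++ [M]) = insert M (cutLetters v) := by
  ext b
  rw [Finset.mem_insert, mem_cutLetters, mem_cutLetters]
  constructor
  · rintro ⟨hb, h⟩
    rcases List.mem_append.mp hb with hb | hb
    · exact Or.inr ⟨hb, fun a c hab hbc hs => h a c hab hbc (hs.trans (List.sublist_append_left _ _))⟩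
    · exact Or.inl (by simpa using hb)
  · rintro (rfl | ⟨hb, h⟩)
    · refine ⟨by simp, fun a c _ hbc hs => ?_⟩
      have hc : c ∈ v ++ [b] := hs.subset (by simp)
      rcases List.mem_append.mp hc with hc | hc
      · have := hM c hc; omega
      · have : c = b := by simpa using hc
        omega
    · refine ⟨by simp [hb], fun a c hab hbc hs => ?_⟩
      rcases pair_sublist_append.mp hs with hs | ⟨_, ha⟩ | hs
      · exact h a c hab hbc hs
      · have : a = M := by simpa using ha
        have := hM b hb
        omega
      · simp at hs

end Patterns

/-! ### Words with the Stirling property and their cutting at the maximum -/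

section RWords

/-- Between two equal letters of `w` there is no larger letter. -/
def IsStirling (w : List ℕ) : Prop := ∀ a b, [a, b, a].Sublist w → b ≤ a

/-- `w` is an `r`-permutation of the set of its letters. -/
def IsRWord (r : ℕ) (w : List ℕ) : Prop := IsStirling w ∧ ∀ a ∈ w, w.count a = r

theorem isRPermutation_iff {r n : ℕ} (hr : 1 ≤ r) {w : List ℕ} :
    IsRPermutation r n w ↔ IsRWord r w ∧ ∀ a, a ∈ w ↔ 1 ≤ a ∧ a ≤ n := by
  have hst : (∀ i j k : Fin w.length, i < j → j < k → w.get i = w.get k → w.get j ≤ w.get i) ↔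
      IsStirling w := by
    constructor
    · intro h a b hs
      obtain ⟨f, hf⟩ := List.sublist_iff_exists_fin_orderEmbedding_get_eq.mp hs
      have h0 := hf ⟨0, by simp⟩
      have h1 := hf ⟨1, by simp⟩
      have h2 := hf ⟨2, by simp⟩
      have := h (f ⟨0, by simp⟩) (f ⟨1, by simp⟩) (f ⟨2, by simp⟩)
        (f.strictMono (by simp)) (f.strictMono (by simp))
        (by rw [← h0, ← h2]; rfl)
      rw [← h0, ← h1] at this
      exact this
    · intro h i j k hij hjk e
      apply h
      rw [List.sublist_iff_exists_fin_orderEmbedding_get_eq]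
      refine ⟨OrderEmbedding.ofStrictMono ![i, j, k] ?_, ?_⟩
      · intro x y hxy
        have hik := hij.trans hjk
        fin_cases x <;> fin_cases y <;> first
          | exact hij
          | exact hjk
          | exact hik
          | exact absurd (Fin.lt_def.mp hxy) (by simp)
      · intro x
        fin_cases x
        · rfl
        · rfl
        · exact e
  rw [IsRPermutation, hst]
  constructor
  · rintro ⟨hc, hs⟩
    have hm : ∀ a, a ∈ w ↔ 1 ≤ a ∧ a ≤ n := by
      intro a
      rw [← List.count_pos_iff, hc a]
      split_ifs with h <;> simp [h]; omega
    refine ⟨⟨hs, fun a ha => ?_⟩, hm⟩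
    rw [hc, if_pos ((hm a).mp ha)]
  · rintro ⟨⟨hs, hc⟩, hm⟩
    refine ⟨fun a => ?_, hs⟩
    split_ifs with h
    · exact hc a ((hm a).mpr h)
    · exact List.count_eq_zero.mpr fun h' => h ((hm a).mp h')

/-- A letter occurring on both sides of `M` would have the larger `M` between two of its copies. -/
theorem isStirling_append_max {α w : List ℕ} {M : ℕ} (hα : ∀ a ∈ α, a < M) (hw : ∀ a ∈ w, a ≤ M) :
    IsStirling (α ++ M :: w) ↔ IsStirling α ∧ IsStirling w ∧ List.Disjoint α w := by
  constructor
  · intro h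
    refine ⟨fun a b hs => h a b (hs.trans (List.sublist_append_left _ _)),
      fun a b hs => h a b
        (hs.trans ((List.sublist_cons_self M w).trans (List.sublist_append_right _ _))), ?_⟩
    intro a ha ha'
    have := h a M (triple_sublist_append.mpr (Or.inr (Or.inr (Or.inl
      ⟨ha, (List.singleton_sublist.mpr ha').cons_cons M⟩))))
    have := hα a ha
    omega
  · rintro ⟨h1, h2, h3⟩ a b hs
    have hcontra : a ∈ α → a ∈ M :: w → False := by
      intro ha ha'
      rcases List.mem_cons.mp ha' with rfl | ha'
      · exact (hα a ha).false
      · exact h3 ha ha'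
    rcases triple_sublist_append.mp hs with h | ⟨h, ha⟩ | ⟨ha, h⟩ | h
    · exact h1 a b h
    · exact (hcontra (h.subset (by simp)) ha).elim
    · exact (hcontra ha (h.subset (by simp))).elim
    · cases h with
      | cons _ h => exact h2 a b h
      | cons_cons _ h => exact hw b (h.subset (by simp))

theorem isStirling_intercalate {M : ℕ} {f : List (List ℕ)} (hM : ∀ a ∈ f.flatten, a < M) :
    IsStirling ([M].intercalate f) ↔ (∀ α ∈ f, IsStirling α) ∧ f.Pairwise List.Disjoint := by
  induction f with
  | nil => simp [IsStirling]
  | cons α f ih =>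
    have ih' := ih fun a ha => hM a (by simp_all)
    rcases f with _ | ⟨β, f⟩
    · simp [List.intercalate_singleton]
    · have hle : ∀ a ∈ [M].intercalate (β :: f), a ≤ M := by
        intro a ha
        by_cases h : a = M
        · exact h.le
        · exact (hM a (by
            have := (mem_intercalate h _).mp ha
            rw [List.flatten_cons]
            exact List.mem_append_right _ this)).le
      have hα : ∀ a ∈ α, a < M := fun a ha => hM a (by simp [ha])
      have hdis : List.Disjoint α ([M].intercalate (β :: f)) ↔
          ∀ γ ∈ β :: f, List.Disjoint α γ := by
        constructor
        · intro h γ hγ a ha ha'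
          exact h ha ((mem_intercalate (hα a ha).ne _).mpr (List.mem_flatten.mpr ⟨γ, hγ, ha'⟩))
        · intro h a ha ha'
          obtain ⟨γ, hγ, h'⟩ := List.mem_flatten.mp ((mem_intercalate (hα a ha).ne _).mp ha')
          exact h γ hγ ha h'
      rw [List.intercalate_cons_cons, List.append_assoc, List.singleton_append,
        isStirling_append_max hα hle, ih', hdis, List.pairwise_cons (a := α),
        List.forall_mem_cons (a := α)]
      generalize (∀ x ∈ β :: f, IsStirling x) = p
      generalize (∀ γ ∈ β :: f, α.Disjoint γ) = q
      tauto

theorem count_intercalate {M a : ℕ} (ha : a ≠ M) (f : List (List ℕ)) :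
    ([M].intercalate f).count a = f.flatten.count a := by
  induction f with
  | nil => simp
  | cons α f ih =>
    rcases f with _ | ⟨β, f⟩
    · simp [List.intercalate_singleton]
    · rw [List.intercalate_cons_cons, List.flatten_cons, List.count_append, List.count_append, ih,
        List.count_append]
      simp [ha.symm]

theorem count_intercalate_self {M : ℕ} {f : List (List ℕ)} (hM : ∀ α ∈ f, M ∉ α) :
    ([M].intercalate f).count M = f.length - 1 := by
  induction f with
  | nil => simp
  | cons α f ih =>
    rcases f with _ | ⟨β, f⟩
    · simpa [List.intercalate_singleton, List.count_eq_zero] using hM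
    · have : M ∉ α := hM α (by simp)
      rw [List.intercalate_cons_cons, List.count_append, List.count_append,
        ih fun γ hγ => hM γ (List.mem_cons_of_mem _ hγ)]
      simp [List.count_eq_zero.mpr this]
      omega

theorem count_flatten_of_disjoint {f : List (List ℕ)} (hf : f.Pairwise List.Disjoint)
    {α : List ℕ} (hα : α ∈ f) {a : ℕ} (ha : a ∈ α) : f.flatten.count a = α.count a := by
  induction f with
  | nil => simp at hα
  | cons β f ih =>
    rw [List.pairwise_cons] at hf
    rw [List.flatten_cons, List.count_append]
    rcases List.mem_cons.mp hα with rfl | hα'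
    · have : a ∉ f.flatten := by
        intro h
        obtain ⟨γ, hγ, h⟩ := List.mem_flatten.mp h
        exact hf.1 γ hγ ha h
      rw [List.count_eq_zero.mpr this, add_zero]
    · have : a ∉ β := fun h => hf.1 α hα' h ha
      rw [List.count_eq_zero.mpr this, zero_add, ih hf.2 hα']

/-- The blocks between copies of the maximum have disjoint letter sets, and each maximum is emitted
once, so sorting collapses multiplicities. -/
theorem nodup_stackSort {w : List ℕ} (hw : IsStirling w) : (stackSort w).Nodup := by
  induction w using stackSort_induction with
  | nil => simp [stackSort_nil]
  | step w hne ih =>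
    set m := maxLetter w with hm
    have hlt : ∀ a ∈ (w.splitOn m).flatten, a < m := by
      intro a ha
      obtain ⟨u, hu, hau⟩ := List.mem_flatten.mp ha
      exact lt_of_le_of_ne (le_maxLetter (mem_of_mem_splitOn hu hau))
        fun h => notMem_of_mem_splitOn hu (h ▸ hau)
    have hs := (isStirling_intercalate hlt).mp (by rwa [List.intercalate_splitOn])
    rw [stackSort_of_ne_nil hne, ← hm, List.nodup_append]
    refine ⟨?_, by simp, ?_⟩
    · rw [List.nodup_flatten]
      refine ⟨?_, ?_⟩
      · intro l hl
        obtain ⟨u, hu, rfl⟩ := List.mem_map.mp hl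
        exact ih u hu (hs.1 u hu)
      · rw [List.pairwise_map]
        exact hs.2.imp fun h a ha hb => h ((mem_stackSort _).mp ha) ((mem_stackSort _).mp hb)
    · intro a ha b hb
      have := (mem_forestSort _).mp ha
      have h1 := hlt a this
      have : b = m := by simpa using hb
      omega

/-- The two-stack-sortable `r`-permutations of `[n]`. -/
def sortableTrees (r n : ℕ) : Set (List ℕ) :=
  {w | IsRWord r w ∧ (∀ a, a ∈ w ↔ 1 ≤ a ∧ a ≤ n) ∧ Avoids231 (stackSort w)}

/-- Lists of `d` words, which are `r`-permutations of disjoint sets with union `[N]`, whose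
concatenated stack-sorting image avoids `231`. -/
def sortableForests (r d N : ℕ) : Set (List (List ℕ)) :=
  {f | f.length = d ∧ (∀ α ∈ f, IsRWord r α) ∧ f.Pairwise List.Disjoint ∧
    (∀ a, a ∈ f.flatten ↔ 1 ≤ a ∧ a ≤ N) ∧ Avoids231 (forestSort f)}

theorem mem_sortableTrees_iff {r n : ℕ} (hr : 1 ≤ r) {w : List ℕ} :
    w ∈ sortableTrees r n ↔
      IsRPermutation r n w ∧ stackSort (stackSort w) = List.range' 1 n := by
  rw [isRPermutation_iff hr, and_assoc]
  refine and_congr_right fun hw => and_congr_right fun hm => ?_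
  have hnd := nodup_stackSort hw.1
  rw [← pairwise_stackSort_iff hnd]
  constructor
  · intro h
    refine List.Perm.eq_of_pairwise (le := (· < ·)) (fun a b _ _ h1 h2 => by omega) h
      List.pairwise_lt_range' ?_
    rw [List.perm_ext_iff_of_nodup (h.imp fun h => h.ne) List.nodup_range']
    intro a
    rw [mem_stackSort, mem_stackSort, hm, List.mem_range'_1]
    omega
  · intro h
    rw [h]
    exact List.pairwise_lt_range'

/-- The `r` copies of n + 1 cut the word into r + 1 blocks; the final n + 1 of the sorted word takes
part in no 231. -/
theorem sortableTrees_succ {r n : ℕ} (hr : 1 ≤ r) :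
    sortableTrees r (n + 1) = ([n + 1].intercalate ·) '' sortableForests r (r + 1) n := by
  have hflat : ∀ f : List (List ℕ), f ∈ sortableForests r (r + 1) n →
      ∀ a ∈ f.flatten, a < n + 1 := fun f hf a ha => by
    have := (hf.2.2.2.1 a).mp ha
    omega
  ext w
  constructor
  · rintro ⟨⟨hst, hcount⟩, hmem, hav⟩
    set f := w.splitOn (n + 1) with hf
    have hw : [n + 1].intercalate f = w := List.intercalate_splitOn _
    have hnot : ∀ α ∈ f, n + 1 ∉ α := fun α hα => notMem_of_mem_splitOn hα
    have hlen : f.length = r + 1 := by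
      have h1 := count_intercalate_self hnot
      rw [hw, hcount _ ((hmem _).mpr (by omega))] at h1
      omega
    have hfl : ∀ a, a ∈ f.flatten ↔ 1 ≤ a ∧ a ≤ n := by
      intro a
      by_cases ha : a = n + 1
      · subst ha
        simp only [List.mem_flatten, iff_def]
        refine ⟨fun ⟨α, hα, h⟩ => (hnot α hα h).elim, fun h => by omega⟩
      · rw [← mem_intercalate ha, hw, hmem]
        omega
    have hlt : ∀ a ∈ f.flatten, a < n + 1 := fun a ha => by
      have := (hfl a).mp ha
      omega
    rw [← hw, isStirling_intercalate hlt] at hst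
    refine ⟨f, ⟨hlen, fun α hα => ⟨hst.1 α hα, fun a ha => ?_⟩, hst.2, hfl, ?_⟩, hw⟩
    · have hane : a ≠ n + 1 := fun h => hnot α hα (h ▸ ha)
      rw [← count_flatten_of_disjoint hst.2 hα ha, ← count_intercalate hane, hw]
      exact hcount a (mem_of_mem_splitOn hα ha)
    · rw [← hw, stackSort_intercalate (by omega) hlt, avoids231_append_singleton_max] at hav
      · exact hav
      · intro a ha
        exact hlt a ((mem_forestSort f).mp ha)
  · rintro ⟨f, hf, rfl⟩
    have hlt := hflat f hf
    obtain ⟨hlen, hword, hdis, hfl, hav⟩ := hf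
    have hnot : ∀ α ∈ f, n + 1 ∉ α := fun α hα h =>
      (hlt (n + 1) (List.mem_flatten.mpr ⟨α, hα, h⟩)).false
    have hself : n + 1 ∈ [n + 1].intercalate f := by
      rw [← List.count_pos_iff, count_intercalate_self hnot]
      omega
    refine ⟨⟨(isStirling_intercalate hlt).mpr ⟨fun α hα => (hword α hα).1, hdis⟩, ?_⟩, ?_, ?_⟩
    · intro a ha
      by_cases h : a = n + 1
      · rw [h, count_intercalate_self hnot]
        omega
      · rw [count_intercalate h]
        obtain ⟨α, hα, haα⟩ := List.mem_flatten.mp ((mem_intercalate h f).mp ha)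
        rw [count_flatten_of_disjoint hdis hα haα, (hword α hα).2 a haα]
    · intro a
      by_cases h : a = n + 1
      · simp [h, hself]
      · simp only [mem_intercalate h, hfl]
        omega
    · simp only
      rw [stackSort_intercalate (by omega) hlt, avoids231_append_singleton_max]
      · exact hav
      · intro a ha
        exact hlt a ((mem_forestSort f).mp ha)

theorem injOn_intercalate {r n : ℕ} :
    Set.InjOn ([n + 1].intercalate ·) (sortableForests r (r + 1) n) := by
  intro f hf g hg h
  have key : ∀ f ∈ sortableForests r (r + 1) n, ([n + 1].intercalate f).splitOn (n + 1) = f := by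
    intro f hf
    apply List.splitOn_intercalate
    · intro α hα h
      have := (hf.2.2.2.1 (n + 1)).mp (List.mem_flatten.mpr ⟨α, hα, h⟩)
      omega
    · rintro rfl
      have := hf.1
      simp at this
  rw [← key f hf, ← key g hg]
  exact congrArg (List.splitOn (n + 1)) h

end RWords

/-! ### Placing one tree in front of a forest -/

section Merge

/-- A straddling 231 either has its 2 in π, its 3 equal to `p` and its 1 in τ, or its 2 equal to `p`
and the rest in τ; a 2 in π with the rest in τ is excluded by the first condition. -/
theorem avoids231_merge {π τ : List ℕ} {p : ℕ} (hπ : ∀ x ∈ π, x < p)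
    (hd : List.Disjoint (π ++ [p]) τ) :
    Avoids231 (π ++ [p] ++ τ) ↔ Avoids231 (π ++ [p]) ∧ Avoids231 τ ∧
      (∀ b ∈ π, ∀ a ∈ τ, b < a) ∧ ∀ a c, a < p → p < c → ¬ [c, a].Sublist τ := by
  constructor
  · intro h
    refine ⟨h.sublist (List.sublist_append_left _ _), h.sublist (List.sublist_append_right _ _),
      ?_, ?_⟩
    · intro b hb a ha
      by_contra hab
      have hne : b ≠ a := fun e => hd (by simp [hb]) (e ▸ ha)
      exact h a b p (by omega) (hπ b hb)
        (triple_sublist_append.mpr (Or.inr (Or.inl ⟨pair_sublist_of_mem hb, ha⟩)))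
    · intro a c hap hpc hs
      exact h a p c hap hpc
        (triple_sublist_append.mpr (Or.inr (Or.inr (Or.inl ⟨by simp, hs⟩))))
  · rintro ⟨h1, h2, h3, h4⟩ a b c hab hbc hs
    have hle : ∀ x ∈ π ++ [p], x ∈ π ∨ x = p := fun x hx => by simpa using hx
    rcases triple_sublist_append.mp hs with h | ⟨h, ha⟩ | ⟨hb, h⟩ | h
    · exact h1 a b c hab hbc h
    · have hb := hle b (h.subset (by simp))
      have hc := hle c (h.subset (by simp))
      rcases hb with hb | rfl
      · have := h3 b hb a ha
        omega
      · rcases hc with hc | rfl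
        · have := hπ c hc
          omega
        · omega
    · rcases hle b hb with hb | rfl
      · have := h3 b hb a (h.subset (by simp))
        omega
      · exact h4 a c hab hbc h
    · exact h2 a b c hab hbc h

/-- Letters of τ below `p` lose the cut property because `p` precedes them; all other cut letters
survive. -/
theorem cutLetters_merge {π τ : List ℕ} {p : ℕ} (hπ : ∀ x ∈ π, x < p)
    (hd : List.Disjoint (π ++ [p]) τ) (hlt : ∀ b ∈ π, ∀ a ∈ τ, b < a)
    (hp : ∀ a c, a < p → p < c → ¬ [c, a].Sublist τ) :
    cutLetters (π ++ [p] ++ τ) = cutLetters (π ++ [p]) ∪ (cutLetters τ).filter (p < ·) := by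
  have hle : ∀ x ∈ π ++ [p], x ∈ π ∨ x = p := fun x hx => by simpa using hx
  ext b
  rw [Finset.mem_union, Finset.mem_filter, mem_cutLetters, mem_cutLetters, mem_cutLetters]
  constructor
  · rintro ⟨hb, h⟩
    rcases List.mem_append.mp hb with hb | hb
    · exact Or.inl ⟨hb, fun a c hab hbc hs => h a c hab hbc (hs.trans (List.sublist_append_left _ _))⟩
    · refine Or.inr ⟨⟨hb, fun a c hab hbc hs =>
        h a c hab hbc (hs.trans (List.sublist_append_right _ _))⟩, ?_⟩
      by_contra hpb
      have hne : b ≠ p := fun e => hd (by simp) (e ▸ hb)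
      exact h b p le_rfl (by omega) (pair_sublist_append.mpr (Or.inr (Or.inl ⟨by simp, hb⟩)))
  · rintro (⟨hb, h⟩ | ⟨⟨hb, h⟩, hpb⟩)
    · refine ⟨List.mem_append_left _ hb, fun a c hab hbc hs => ?_⟩
      rcases pair_sublist_append.mp hs with hs | ⟨hc, ha⟩ | hs
      · exact h a c hab hbc hs
      · rcases hle b hb with hb | rfl
        · have := hlt b hb a ha
          omega
        · rcases hle c hc with hc | rfl
          · have := hπ c hc
            omega
          · omega
      · have ha : a ∈ τ := hs.subset (by simp)
        rcases hle b hb with hb | rfl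
        · have := hlt b hb a ha
          omega
        · have hne : a ≠ b := fun e => hd (a := b) (by simp) (e ▸ ha)
          exact hp a c (by omega) hbc ‹_›
    · refine ⟨List.mem_append_right _ hb, fun a c hab hbc hs => ?_⟩
      have hcp : c ∉ π ++ [p] := by
        intro hc
        rcases hle c hc with hc | rfl
        · have := hπ c hc
          omega
        · omega
      rcases pair_sublist_append.mp hs with hs | ⟨hc, _⟩ | hs
      · exact hcp (hs.subset (by simp))
      · exact hcp hc
      · exact h a c hab hbc hs

theorem exists_stackSort_eq_append_singleton {α : List ℕ} (hα : α ≠ []) :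
    ∃ π, stackSort α = π ++ [maxLetter α] ∧ ∀ x, x ∈ π ↔ x ∈ α ∧ x < maxLetter α := by
  refine ⟨_, stackSort_of_ne_nil hα, fun x => ?_⟩
  have h1 := mem_forestSort (a := x) (α.splitOn (maxLetter α))
  rw [forestSort] at h1
  rw [h1]
  constructor
  · intro hx
    obtain ⟨u, hu, hxu⟩ := List.mem_flatten.mp hx
    have hxα := mem_of_mem_splitOn hu hxu
    exact ⟨hxα, lt_of_le_of_ne (le_maxLetter hxα) fun h => notMem_of_mem_splitOn hu (h ▸ hxu)⟩
  · rintro ⟨hx, hlt⟩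
    exact (mem_splitOn_flatten hlt.ne α).mpr hx

end Merge

/-! ### Standardization of the first tree and of the remaining forest -/

section Relabelling

theorem isRWord_map {r : ℕ} {g : ℕ → ℕ} {w : List ℕ} (hg : StrictMonoOn g {a | a ∈ w}) :
    IsRWord r (w.map g) ↔ IsRWord r w := by
  refine and_congr ⟨fun h a b hs => ?_, fun h a b hs => ?_⟩ ⟨fun h a ha => ?_, fun h a ha => ?_⟩
  · have ha : a ∈ w := hs.subset (by simp)
    have hb : b ∈ w := hs.subset (by simp)
    exact (hg.le_iff_le hb ha).mp (h (g a) (g b) (hs.map g))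
  · have hmem : ∀ x ∈ [a, b, a], ∃ y ∈ w, g y = x := fun x hx => List.mem_map.mp (hs.subset hx)
    obtain ⟨a, ha, rfl⟩ := hmem a (by simp)
    obtain ⟨b, hb, rfl⟩ := hmem b (by simp)
    refine (hg.le_iff_le hb ha).mpr (h a b ?_)
    rw [← sublist_map_iff_of_injOn hg.injOn (by simp [ha, hb])]
    exact hs
  · rw [← h (g a) (List.mem_map_of_mem ha), List.count, List.count, List.countP_map]
    apply List.countP_congr
    intro x hx
    simp only [Function.comp, beq_iff_eq]
    exact ⟨fun h => h ▸ rfl, fun h => hg.injOn hx ha h⟩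
  · obtain ⟨b, hb, rfl⟩ := List.mem_map.mp ha
    rw [← h b hb, List.count, List.count, List.countP_map]
    apply List.countP_congr
    intro x hx
    simp only [Function.comp, beq_iff_eq]
    exact ⟨fun h => hg.injOn hx hb h, fun h => h ▸ rfl⟩

theorem mem_map_map_flatten {g : ℕ → ℕ} {f : List (List ℕ)} {a : ℕ} :
    a ∈ (f.map (List.map g)).flatten ↔ ∃ b ∈ f.flatten, g b = a := by
  rw [← List.map_flatten, List.mem_map]

theorem pairwise_disjoint_map {g : ℕ → ℕ} {f : List (List ℕ)}
    (hg : Set.InjOn g {a | a ∈ f.flatten}) :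
    (f.map (List.map g)).Pairwise List.Disjoint ↔ f.Pairwise List.Disjoint := by
  rw [List.pairwise_map]
  apply List.Pairwise.iff_of_mem
  intro α β hα hβ
  constructor
  · intro h a ha hb
    exact h (List.mem_map_of_mem ha) (List.mem_map_of_mem hb)
  · intro h x hx hy
    obtain ⟨a, ha, rfl⟩ := List.mem_map.mp hx
    obtain ⟨b, hb, hab⟩ := List.mem_map.mp hy
    have := hg (List.mem_flatten.mpr ⟨β, hβ, hb⟩) (List.mem_flatten.mpr ⟨α, hα, ha⟩) hab
    exact h ha (this ▸ hb)

/-- The relabelling of the first tree in a forest: `{1, …, m}` is sent to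
`{1, …, m - 1} ∪ {m + q}`. -/
def headLabel (m q i : ℕ) : ℕ := if i < m then i else m + q

/-- The relabelling of the remaining trees in a forest, onto the positive integers that are not
values of `headLabel m q`. -/
def tailLabel (m q j : ℕ) : ℕ := if j ≤ q then m - 1 + j else m + j

theorem strictMonoOn_headLabel {m q : ℕ} : StrictMonoOn (headLabel m q) (Set.Icc 1 m) := by
  intro a ha b hb hab
  simp only [Set.mem_Icc] at ha hb
  unfold headLabel
  split_ifs <;> omega

theorem strictMono_tailLabel {m q : ℕ} : StrictMono (tailLabel m q) := by
  intro a b hab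
  unfold tailLabel
  split_ifs <;> omega

/-- Assemble a forest from its first tree and the remaining ones. -/
def consForest (m q : ℕ) (T : List ℕ) (F : List (List ℕ)) : List (List ℕ) :=
  T.map (headLabel m q) :: F.map (List.map (tailLabel m q))

/-- Level 0 is the vacuous cut below every letter, so the admissible root positions number one more
than the cut letters. -/
theorem mem_insert_zero_cutLetters {n q : ℕ} {v : List ℕ} (hv : ∀ a, a ∈ v ↔ 1 ≤ a ∧ a ≤ n) :
    q ∈ insert 0 (cutLetters v) ↔ q ≤ n ∧ ∀ a c, a ≤ q → q < c → ¬ [c, a].Sublist v := by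
  rw [Finset.mem_insert, mem_cutLetters, hv]
  constructor
  · rintro (rfl | ⟨h1, h2⟩)
    · refine ⟨Nat.zero_le _, fun a c ha _ hs => ?_⟩
      have := (hv a).mp (hs.subset (by simp))
      omega
    · exact ⟨h1.2, h2⟩
  · rintro ⟨h1, h2⟩
    rcases Nat.eq_zero_or_pos q with h | h
    · exact Or.inl h
    · exact Or.inr ⟨⟨h, h1⟩, h2⟩

-- The heart of the decomposition: after relabelling, the root m + q falls between the labels of q
-- and q + 1 in the forest, so compatibility means that `q` is an admissible cut.
set_option maxHeartbeats 800000 in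
theorem consForest_mem_iff {r d N m q : ℕ} {T : List ℕ} {F : List (List ℕ)} (hm : 1 ≤ m)
    (hmN : m ≤ N) (hq : q ≤ N - m) (hT : ∀ a, a ∈ T ↔ 1 ≤ a ∧ a ≤ m)
    (hF : ∀ a, a ∈ F.flatten ↔ 1 ≤ a ∧ a ≤ N - m) :
    (consForest m q T F ∈ sortableForests r (d + 1) N ↔
      T ∈ sortableTrees r m ∧ F ∈ sortableForests r d (N - m) ∧
        q ∈ insert 0 (cutLetters (forestSort F))) ∧
    (q ∈ insert 0 (cutLetters (forestSort F)) →
      (cutLetters (forestSort (consForest m q T F))).card =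
        (cutLetters (stackSort T)).card +
          ((cutLetters (forestSort F)).filter (q < ·)).card) := by
  have hup : StrictMonoOn (headLabel m q) {a | a ∈ T} :=
    strictMonoOn_headLabel.mono fun a ha => (hT a).mp ha
  have hsk : ∀ s, StrictMonoOn (tailLabel m q) s := fun s => strictMono_tailLabel.strictMonoOn s
  have hTne : T ≠ [] := List.ne_nil_of_mem ((hT 1).mpr ⟨le_rfl, hm⟩)
  have hmaxT : maxLetter T = m := maxLetter_eq ((hT m).mpr ⟨hm, le_rfl⟩) fun a ha => ((hT a).mp ha).2
  have hhm : headLabel m q m = m + q := by simp [headLabel]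
  have hmem_up : ∀ a, a ∈ T.map (headLabel m q) ↔ (1 ≤ a ∧ a < m) ∨ a = m + q := by
    intro a
    simp only [List.mem_map, hT, headLabel]
    constructor
    · rintro ⟨b, hb, rfl⟩
      split_ifs <;> omega
    · rintro (h | rfl)
      · exact ⟨a, by omega, if_pos h.2⟩
      · exact ⟨m, by omega, by simp⟩
  have hmem_sk : ∀ a, a ∈ (F.map (List.map (tailLabel m q))).flatten ↔
      m ≤ a ∧ a ≤ N ∧ a ≠ m + q := by
    intro a
    rw [mem_map_map_flatten]
    simp only [hF, tailLabel]
    constructor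
    · rintro ⟨b, hb, rfl⟩
      split_ifs <;> omega
    · rintro ⟨h1, h2, h3⟩
      by_cases h : a < m + q
      · exact ⟨a - (m - 1), by omega, by split_ifs <;> omega⟩
      · exact ⟨a - m, by omega, by split_ifs <;> omega⟩
  obtain ⟨π, hπ, hπmem⟩ := exists_stackSort_eq_append_singleton (α := T.map (headLabel m q))
    (by simpa using hTne)
  rw [maxLetter_map hTne hup, hmaxT, hhm] at hπ hπmem
  set τ := (forestSort F).map (tailLabel m q) with hτ
  have hτeq : forestSort (F.map (List.map (tailLabel m q))) = τ := forestSort_map (hsk _)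
  have hτmem : ∀ a, a ∈ τ ↔ m ≤ a ∧ a ≤ N ∧ a ≠ m + q := by
    intro a
    rw [← hτeq, mem_forestSort, hmem_sk]
  have hπmem' : ∀ x, x ∈ π ↔ 1 ≤ x ∧ x < m := by
    intro x
    rw [hπmem, hmem_up]
    omega
  have hsort : forestSort (consForest m q T F) = π ++ [m + q] ++ τ := by
    rw [consForest, forestSort_cons, hπ, hτeq]
  have hdisj : List.Disjoint (π ++ [m + q]) τ := by
    intro x hx hx'
    rw [hτmem] at hx'
    simp only [List.mem_append, hπmem', List.mem_singleton] at hx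
    omega
  have hlt : ∀ b ∈ π, ∀ a ∈ τ, b < a := by
    intro b hb a ha
    have := (hπmem' b).mp hb
    have := (hτmem a).mp ha
    omega
  have hfmem : ∀ a, a ∈ forestSort F ↔ 1 ≤ a ∧ a ≤ N - m := fun a => by
    rw [mem_forestSort, hF]
  have hsk_lt : ∀ j, tailLabel m q j < m + q ↔ j ≤ q := by
    intro j
    unfold tailLabel
    split_ifs <;> omega
  have hlt_sk : ∀ j, m + q < tailLabel m q j ↔ q < j := by
    intro j
    unfold tailLabel
    split_ifs <;> omega
  have hcompat : (∀ a c, a < m + q → m + q < c → ¬ [c, a].Sublist τ) ↔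
      q ∈ insert 0 (cutLetters (forestSort F)) := by
    rw [mem_insert_zero_cutLetters hfmem, and_iff_right hq]
    constructor
    · intro h a c ha hc hs
      exact h _ _ ((hsk_lt a).mpr ha) ((hlt_sk c).mpr hc) (hs.map (tailLabel m q))
    · intro h a c ha hc hs
      have hmem : ∀ x ∈ [c, a], ∃ y ∈ forestSort F, tailLabel m q y = x := fun x hx =>
        List.mem_map.mp (hs.subset hx)
      obtain ⟨a, ha', rfl⟩ := hmem a (by simp)
      obtain ⟨c, hc', rfl⟩ := hmem c (by simp)
      refine h a c ((hsk_lt a).mp ha) ((hlt_sk c).mp hc) ?_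
      rw [← sublist_map_iff_of_injOn (hsk _).injOn (by simp [ha', hc'])]
      exact hs
  have hπlt : ∀ x ∈ π, x < m + q := fun x hx => by
    have := (hπmem' x).mp hx
    omega
  have hπT : π ++ [m + q] = (stackSort T).map (headLabel m q) := by
    rw [← hπ, stackSort_map hup]
  have hupS : StrictMonoOn (headLabel m q) {a | a ∈ stackSort T} :=
    hup.mono fun a ha => (mem_stackSort T).mp ha
  constructor
  · have hav : Avoids231 (forestSort (consForest m q T F)) ↔
        Avoids231 (stackSort T) ∧ Avoids231 (forestSort F) ∧
          q ∈ insert 0 (cutLetters (forestSort F)) := by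
      rw [hsort, avoids231_merge hπlt hdisj, hcompat, hπT, avoids231_map hupS, hτ,
        avoids231_map (hsk _), ← hτ, and_iff_right hlt]
    have hlen : (consForest m q T F).length = d + 1 ↔ F.length = d := by simp [consForest]
    have hword : (∀ α ∈ consForest m q T F, IsRWord r α) ↔
        IsRWord r T ∧ ∀ α ∈ F, IsRWord r α := by
      rw [consForest, List.forall_mem_cons, isRWord_map hup, List.forall_mem_map]
      refine and_congr_right fun _ => forall₂_congr fun α _ => isRWord_map (hsk _)
    have hdis : (consForest m q T F).Pairwise List.Disjoint ↔ F.Pairwise List.Disjoint := by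
      rw [consForest, List.pairwise_cons, pairwise_disjoint_map (hsk _).injOn]
      refine and_iff_right ?_
      intro β hβ x hx hx'
      have h1 := (hmem_up x).mp hx
      have h2 := (hmem_sk x).mp (List.mem_flatten.mpr ⟨β, hβ, hx'⟩)
      omega
    have hflat : ∀ a, a ∈ (consForest m q T F).flatten ↔ 1 ≤ a ∧ a ≤ N := by
      intro a
      rw [consForest, List.flatten_cons, List.mem_append, hmem_up, hmem_sk]
      omega
    constructor
    · rintro ⟨h1, h2, h3, -, h5⟩
      exact ⟨⟨(hword.mp h2).1, hT, (hav.mp h5).1⟩,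
        ⟨hlen.mp h1, (hword.mp h2).2, hdis.mp h3, hF, (hav.mp h5).2.1⟩, (hav.mp h5).2.2⟩
    · rintro ⟨⟨h1, -, h2⟩, ⟨h3, h4, h5, -, h6⟩, h7⟩
      exact ⟨hlen.mpr h3, hword.mpr ⟨h1, h4⟩, hdis.mpr h5, hflat, hav.mpr ⟨h2, h6, h7⟩⟩
  · intro hqc
    rw [hsort, cutLetters_merge hπlt hdisj hlt (hcompat.mpr hqc), Finset.card_union_of_disjoint,
      hπT, cutLetters_map hupS, Finset.card_image_of_injOn, hτ, cutLetters_map (hsk _)]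
    · congr 1
      rw [Finset.filter_image, Finset.card_image_of_injective _ strictMono_tailLabel.injective]
      congr 1
      ext j
      simp only [Finset.mem_filter, hlt_sk]
    · exact hupS.injOn.mono fun a ha => (mem_cutLetters.mp ha).1
    · rw [Finset.disjoint_left]
      intro x hx hx'
      exact hdisj (mem_cutLetters.mp hx).1 (mem_cutLetters.mp (Finset.mem_filter.mp hx').1).1

/-- Every forest with nonempty first word is obtained from its first tree and the remaining ones. -/
theorem exists_eq_consForest {r d N : ℕ} {α : List ℕ} {f : List (List ℕ)} (hα : α ≠ [])
    (h : α :: f ∈ sortableForests r (d + 1) N) :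
    ∃ m q T F, 1 ≤ m ∧ m ≤ N ∧ q ≤ N - m ∧ (∀ a, a ∈ T ↔ 1 ≤ a ∧ a ≤ m) ∧
      (∀ a, a ∈ F.flatten ↔ 1 ≤ a ∧ a ≤ N - m) ∧ α :: f = consForest m q T F := by
  obtain ⟨-, -, hdis, hfl, hav⟩ := h
  obtain ⟨π, hπ, hπmem⟩ := exists_stackSort_eq_append_singleton hα
  set p := maxLetter α with hp
  have hpα : p ∈ α := maxLetter_mem hα
  have hdα : List.Disjoint α f.flatten := by
    intro a ha ha'
    obtain ⟨β, hβ, h'⟩ := List.mem_flatten.mp ha'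
    exact (List.pairwise_cons.mp hdis).1 β hβ ha h'
  rw [forestSort_cons, hπ, avoids231_merge] at hav
  rotate_left
  · exact fun x hx => ((hπmem x).mp hx).2
  · rw [← hπ]
    intro a ha ha'
    exact hdα ((mem_stackSort α).mp ha) ((mem_forestSort f).mp ha')
  obtain ⟨-, -, hlt, -⟩ := hav
  have hmem : ∀ a, (a ∈ α ∨ a ∈ f.flatten) ↔ 1 ≤ a ∧ a ≤ N := fun a => by
    rw [← hfl, List.flatten_cons, List.mem_append]
  set m := α.toFinset.card with hm
  have hinit : ∀ b, b ∈ α → b < p → ∀ c, 1 ≤ c → c < b → c ∈ α := by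
    intro b hb hbp c hc hcb
    have hbN := (hmem b).mp (Or.inl hb)
    rcases (hmem c).mpr ⟨hc, by omega⟩ with h | h
    · exact h
    · have := hlt b ((hπmem b).mpr ⟨hb, hbp⟩) c ((mem_forestSort f).mpr h)
      omega
  -- The non-root letters lie below the rest of the forest, so they form an initial interval: a
  -- missing c < m would confine all m - 1 of them to [1, c).
  have herase : α.toFinset.erase p = Finset.Ico 1 m := by
    have hcard : (α.toFinset.erase p).card = m - 1 :=
      Finset.card_erase_of_mem (by simpa using hpα)
    symm
    apply Finset.eq_of_subset_of_card_le
    · intro c hc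
      rw [Finset.mem_Ico] at hc
      by_contra hcn
      have hsub : α.toFinset.erase p ⊆ Finset.Ico 1 c := by
        intro b hb
        have hb' := hb
        simp only [Finset.mem_erase, List.mem_toFinset] at hb
        have hbp : b < p := lt_of_le_of_ne (le_maxLetter hb.2) hb.1
        have hb1 := (hmem b).mp (Or.inl hb.2)
        rw [Finset.mem_Ico]
        refine ⟨hb1.1, ?_⟩
        by_contra hcb
        apply hcn
        have hne : b ≠ c := fun e => hcn (e ▸ hb')
        have := hinit b hb.2 hbp c hc.1 (by omega)
        simp only [Finset.mem_erase, List.mem_toFinset]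
        exact ⟨by omega, this⟩
      have := Finset.card_le_card hsub
      rw [hcard, Nat.card_Ico] at this
      omega
    · rw [hcard, Nat.card_Ico]
  have hm1 : 1 ≤ m := Finset.card_pos.mpr ⟨p, by simpa using hpα⟩
  have hαmem : ∀ a, a ∈ α ↔ (1 ≤ a ∧ a < m) ∨ a = p := by
    intro a
    have := congrArg (a ∈ ·) herase
    simp only [Finset.mem_erase, List.mem_toFinset, Finset.mem_Ico, eq_iff_iff] at this
    by_cases hap : a = p
    · simp [hap, hpα]
    · rw [← this]
      simp [hap]
  have hpN := (hmem p).mp (Or.inl hpα)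
  have hmp : m ≤ p := by
    by_contra hcon
    have : p ∈ α.toFinset.erase p := by
      rw [herase, Finset.mem_Ico]
      omega
    simp at this
  have hfmem : ∀ a, a ∈ f.flatten ↔ m ≤ a ∧ a ≤ N ∧ a ≠ p := by
    intro a
    constructor
    · intro ha
      have h1 := (hmem a).mp (Or.inr ha)
      have h2 : a ∉ α := fun h => hdα h ha
      rw [hαmem] at h2
      omega
    · intro ha
      refine ((hmem a).mpr (by omega)).resolve_left fun h => ?_
      rw [hαmem] at h
      omega
  -- Standardization lowers the root from p to m, fixing the other letters of the tree; the forest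
  -- letters are shifted down past m - 1 or m tree letters according to their side of p.
  refine ⟨m, p - m, α.map (min · m),
    f.map (List.map fun j => if j < p then j - (m - 1) else j - m), hm1, by omega, by omega,
    ?_, ?_, ?_⟩
  · intro a
    simp only [List.mem_map, hαmem]
    constructor
    · rintro ⟨b, hb, rfl⟩
      omega
    · intro ha
      by_cases h : a = m
      · exact ⟨p, Or.inr rfl, by omega⟩
      · exact ⟨a, Or.inl (by omega), by omega⟩
  · intro a
    rw [mem_map_map_flatten]
    simp only [hfmem]
    constructor
    · rintro ⟨b, hb, rfl⟩
      split_ifs <;> omega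
    · intro ha
      by_cases h : a ≤ p - m
      · exact ⟨a + (m - 1), by omega, by split_ifs <;> omega⟩
      · exact ⟨a + m, by omega, by split_ifs <;> omega⟩
  · rw [consForest, List.map_map, List.map_map]
    have h1 : ∀ a ∈ α, (headLabel m (p - m) ∘ (min · m)) a = id a := by
      intro a ha
      rw [hαmem] at ha
      simp only [Function.comp, headLabel, id]
      split_ifs <;> omega
    have h2 : ∀ β ∈ f, (List.map (tailLabel m (p - m)) ∘
        List.map fun j => if j < p then j - (m - 1) else j - m) β = id β := by
      intro β hβ
      rw [Function.comp, List.map_map, id]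
      conv_rhs => rw [← List.map_id β]
      apply List.map_congr_left
      intro a ha
      have := (hfmem a).mp (List.mem_flatten.mpr ⟨β, hβ, ha⟩)
      simp only [Function.comp, tailLabel, id]
      split_ifs <;> omega
    rw [List.map_congr_left h1, List.map_congr_left h2, List.map_id, List.map_id]

end Relabelling

/-! ### Descents of a word cut at its maximum -/

section Descents

theorem IsDescent.mem {w : List ℕ} {i a : ℕ} (h : IsDescent w i a) : a ∈ w := by
  rcases i with _ | i <;> obtain ⟨u, v, b, rfl, -, -⟩ := h <;> simp

theorem finite_descents (w : List ℕ) (i : ℕ) : (descents w i).Finite :=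
  (List.finite_toSet w).subset fun _ h => IsDescent.mem h

theorem descents_map {g : ℕ → ℕ} {w : List ℕ} (hg : StrictMonoOn g {a | a ∈ w}) (i : ℕ) :
    descents (w.map g) i = g '' descents w i := by
  ext a'
  constructor
  · intro h
    rcases i with _ | i
    · obtain ⟨u', v', b', e, hba, hu⟩ := h
      obtain ⟨u, t, rfl, rfl, e₁⟩ := List.map_eq_append_iff.mp e
      obtain ⟨b, t, rfl, rfl, e₂⟩ := List.map_eq_cons_iff.mp e₁
      obtain ⟨a, v, rfl, rfl, rfl⟩ := List.map_eq_cons_iff.mp e₂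
      refine ⟨a, ⟨u, v, b, rfl, (hg.lt_iff_lt (by simp) (by simp)).mp hba, fun ha => hu ?_⟩, rfl⟩
      exact List.mem_map_of_mem ha
    · obtain ⟨u', v', b', e, hba, hu⟩ := h
      obtain ⟨u, t, rfl, rfl, e₁⟩ := List.map_eq_append_iff.mp e
      obtain ⟨a, t, rfl, rfl, e₂⟩ := List.map_eq_cons_iff.mp e₁
      obtain ⟨b, v, rfl, rfl, rfl⟩ := List.map_eq_cons_iff.mp e₂
      refine ⟨a, ⟨u, v, b, rfl, (hg.lt_iff_lt (by simp) (by simp)).mp hba, ?_⟩, rfl⟩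
      rw [← hu, List.count, List.count, List.countP_map]
      apply List.countP_congr
      intro x hx
      simp only [Function.comp, beq_iff_eq]
      exact ⟨fun h => h ▸ rfl, fun h => hg.injOn (by simp [hx]) (by simp) h⟩
  · rintro ⟨a, h, rfl⟩
    rcases i with _ | i
    · obtain ⟨u, v, b, rfl, hba, hu⟩ := h
      refine ⟨u.map g, v.map g, g b, by simp, hg (by simp) (by simp) hba, fun ha => hu ?_⟩
      obtain ⟨c, hc, e⟩ := List.mem_map.mp ha
      rwa [← hg.injOn (by simp [hc]) (by simp) e]
    · obtain ⟨u, v, b, rfl, hba, hu⟩ := h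
      refine ⟨u.map g, v.map g, g b, by simp, hg (by simp) (by simp) hba, ?_⟩
      rw [← hu, List.count, List.count, List.countP_map]
      apply List.countP_congr
      intro x hx
      simp only [Function.comp, beq_iff_eq]
      exact ⟨fun h => hg.injOn (by simp [hx]) (by simp) h, fun h => h ▸ rfl⟩

theorem ncard_descents_map {g : ℕ → ℕ} {w : List ℕ} (hg : StrictMonoOn g {a | a ∈ w}) (i : ℕ) :
    (descents (w.map g) i).ncard = (descents w i).ncard := by
  rw [descents_map hg]
  exact Set.InjOn.ncard_image (hg.injOn.mono fun a (h : IsDescent w i a) => h.mem)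

variable {α w : List ℕ} {M : ℕ}

/-- The only new neighbour is the larger letter `M` after α, which creates no descent at a letter of
α. -/
theorem isDescent_append_left (hα : ∀ a ∈ α, a < M) (hd : List.Disjoint α w) {a : ℕ} (ha : a ∈ α)
    (i : ℕ) : IsDescent (α ++ M :: w) i a ↔ IsDescent α i a := by
  have haM := hα a ha
  have haw : a ∉ w := fun h => hd ha h
  rcases i with _ | i
  · constructor
    · rintro ⟨u, v, b, e₀, hba, hu⟩
      rcases List.append_eq_append_iff.mp e₀ with ⟨s, rfl, e⟩ | ⟨s, rfl, e⟩
      · exact (hu (by simp [ha])).elim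
      · rcases s with _ | ⟨x, _ | ⟨y, s⟩⟩
        · simp at e
          omega
        · simp at e
          omega
        · simp at e
          obtain ⟨rfl, rfl, rfl⟩ := e
          exact ⟨u, s, b, rfl, hba, hu⟩
    · rintro ⟨u, v, b, rfl, hba, hu⟩
      exact ⟨u, v ++ M :: w, b, by simp, hba, hu⟩
  · constructor
    · rintro ⟨u, v, b, e₀, hba, hu⟩
      rcases List.append_eq_append_iff.mp e₀ with ⟨s, rfl, e⟩ | ⟨s, rfl, e⟩
      · have : a ∈ M :: w := e ▸ by simp
        rcases List.mem_cons.mp this with rfl | h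
        · omega
        · exact (haw h).elim
      · rcases s with _ | ⟨x, _ | ⟨y, s⟩⟩
        · simp at e
          omega
        · simp at e
          omega
        · simp at e
          obtain ⟨rfl, rfl, rfl⟩ := e
          exact ⟨u, s, b, rfl, hba, hu⟩
    · rintro ⟨u, v, b, rfl, hba, hu⟩
      exact ⟨u, v ++ M :: w, b, by simp, hba, hu⟩

theorem isDescent_append_right (hw : ∀ a ∈ w, a ≤ M) {a : ℕ} (ha : a ∉ α) (haM : a ≠ M) (i : ℕ) :
    IsDescent (α ++ M :: w) i a ↔ IsDescent w i a := by
  rcases i with _ | i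
  · constructor
    · rintro ⟨u, v, b, e₀, hba, hu⟩
      rcases List.append_eq_append_iff.mp e₀ with ⟨s, rfl, e⟩ | ⟨s, rfl, e⟩
      · rcases s with _ | ⟨x, s⟩
        · simp at e
          have := hw a (by simp [e.2])
          omega
        · simp at e
          exact ⟨s, v, b, e.2, hba, fun h => hu (by simp [h])⟩
      · rcases s with _ | ⟨x, _ | ⟨y, s⟩⟩
        · simp at e
          have := hw a (by simp [← e.2])
          omega
        · simp at e
          omega
        · simp at e
          obtain ⟨rfl, rfl, rfl⟩ := e
          simp at ha
    · rintro ⟨u, v, b, rfl, hba, hu⟩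
      exact ⟨α ++ M :: u, v, b, by simp, hba, by simp [ha, haM, hu]⟩
  · constructor
    · rintro ⟨u, v, b, e₀, hba, hu⟩
      rcases List.append_eq_append_iff.mp e₀ with ⟨s, rfl, e⟩ | ⟨s, rfl, e⟩
      · rcases s with _ | ⟨x, s⟩
        · simp at e
          omega
        · simp at e
          obtain ⟨rfl, rfl⟩ := e
          refine ⟨s, v, b, rfl, hba, ?_⟩
          rw [← hu]
          simp [List.count_eq_zero.mpr ha, haM.symm]
      · rcases s with _ | ⟨x, s⟩
        · simp at e
          omega
        · simp at e
          obtain ⟨rfl, e⟩ := e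
          simp at ha
    · rintro ⟨u, v, b, rfl, hba, hu⟩
      refine ⟨α ++ M :: u, v, b, by simp, hba, ?_⟩
      rw [← hu]
      simp [List.count_eq_zero.mpr ha, haM.symm]

theorem isDescent_zero_append_max (hα : ∀ a ∈ α, a < M) :
    IsDescent (α ++ M :: w) 0 M ↔ α ≠ [] := by
  constructor
  · rintro ⟨u, v, b, e, hba, hu⟩ rfl
    rcases u with _ | ⟨x, u⟩
    · simp at e
      omega
    · simp at e
      simp [e.1] at hu
  · intro h
    have hmem := List.getLast_mem h
    refine ⟨α.dropLast, w, α.getLast h, ?_, hα _ hmem, ?_⟩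
    · conv_lhs => rw [← List.dropLast_append_getLast h]
      simp
    · intro hM
      exact (hα M (List.dropLast_subset _ hM)).false

/-- The displayed `M` is the first occurrence; later ones have their index shifted by one. -/
theorem isDescent_succ_append_max (hα : M ∉ α) (i : ℕ) :
    IsDescent (α ++ M :: w) (i + 1) M ↔
      (i = 0 ∧ ∃ b v, w = b :: v ∧ b < M) ∨ ∃ j, i = j + 1 ∧ IsDescent w (j + 1) M := by
  constructor
  · rintro ⟨u, v, b, e₀, hba, hu⟩
    rcases List.append_eq_append_iff.mp e₀ with ⟨s, rfl, e⟩ | ⟨s, rfl, e⟩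
    · rcases s with _ | ⟨x, s⟩
      · simp at e
        refine Or.inl ⟨?_, b, v, e, hba⟩
        rw [← hu]
        simp [List.count_eq_zero.mpr hα]
      · simp at e
        obtain ⟨rfl, rfl⟩ := e
        refine Or.inr ⟨s.count M, ?_, s, v, b, rfl, hba, rfl⟩
        rw [← hu]
        simp [List.count_eq_zero.mpr hα]
    · rcases s with _ | ⟨x, s⟩
      · simp at e
        refine Or.inl ⟨?_, b, v, e.symm, hba⟩
        rw [← hu]
        simpa [List.count_eq_zero] using hα
      · simp at e
        obtain ⟨rfl, e⟩ := e
        simp at hα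
  · rintro (⟨rfl, b, v, rfl, hb⟩ | ⟨j, rfl, u, v, b, rfl, hb, hu⟩)
    · exact ⟨α, v, b, rfl, hb, List.count_eq_zero.mpr hα⟩
    · refine ⟨α ++ M :: u, v, b, by simp, hb, ?_⟩
      rw [← hu]
      simp [List.count_eq_zero.mpr hα]

theorem isDescent_intercalate_of_ne {f : List (List ℕ)} (hM : ∀ a ∈ f.flatten, a < M)
    (hd : f.Pairwise List.Disjoint) {a : ℕ} (ha : a ≠ M) (i : ℕ) :
    IsDescent ([M].intercalate f) i a ↔ ∃ α ∈ f, IsDescent α i a := by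
  induction f with
  | nil =>
    simp only [List.intercalate_nil, List.not_mem_nil, false_and, exists_false, iff_false]
    intro h
    simpa using h.mem
  | cons α f ih =>
    rcases f with _ | ⟨β, f⟩
    · simp [List.intercalate_singleton]
    · rw [List.pairwise_cons] at hd
      have hM' : ∀ a ∈ (β :: f).flatten, a < M := fun a ha => hM a (by
        rw [List.flatten_cons]; exact List.mem_append_right _ ha)
      have hα : ∀ a ∈ α, a < M := fun a ha => hM a (by simp [ha])
      have ih' := ih hM' hd.2
      have hdα : List.Disjoint α ([M].intercalate (β :: f)) := by
        intro x hx hx'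
        obtain ⟨γ, hγ, h'⟩ := List.mem_flatten.mp ((mem_intercalate (hα x hx).ne _).mp hx')
        exact hd.1 γ hγ hx h'
      have hle : ∀ x ∈ [M].intercalate (β :: f), x ≤ M := by
        intro x hx
        by_cases h : x = M
        · exact h.le
        · exact (hM' x ((mem_intercalate h _).mp hx)).le
      rw [List.intercalate_cons_cons, List.append_assoc, List.singleton_append]
      by_cases haα : a ∈ α
      · rw [isDescent_append_left hα hdα haα]
        constructor
        · exact fun h => ⟨α, by simp, h⟩
        · rintro ⟨γ, hγ, h⟩
          rcases List.mem_cons.mp hγ with rfl | hγ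
          · exact h
          · exact (hd.1 γ hγ haα h.mem).elim
      · rw [isDescent_append_right hle haα ha, ih']
        constructor
        · rintro ⟨γ, hγ, h⟩
          exact ⟨γ, List.mem_cons_of_mem _ hγ, h⟩
        · rintro ⟨γ, hγ, h⟩
          rcases List.mem_cons.mp hγ with rfl | hγ
          · exact (haα h.mem).elim
          · exact ⟨γ, hγ, h⟩

/-- Occurrence i + 1 of `M` is followed by slot i + 1. If that slot is empty, the next letter is
another `M` or the word ends. -/
theorem isDescent_succ_intercalate_self {f : List (List ℕ)} (hM : ∀ a ∈ f.flatten, a < M)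
    (i : ℕ) : IsDescent ([M].intercalate f) (i + 1) M ↔ f.getD (i + 1) [] ≠ [] := by
  induction f generalizing i with
  | nil =>
    simp only [List.intercalate_nil, List.getD_nil, ne_eq, not_true_eq_false, iff_false]
    intro h
    simpa using h.mem
  | cons α f ih =>
    rcases f with _ | ⟨β, f⟩
    · simp only [List.intercalate_singleton, List.getD_cons_succ, List.getD_nil, ne_eq,
        not_true_eq_false, iff_false]
      intro h
      exact (hM M (by simpa using h.mem)).false
    · have hM' : ∀ a ∈ (β :: f).flatten, a < M := fun a ha => hM a (by
        rw [List.flatten_cons]; exact List.mem_append_right _ ha)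
      have hα : M ∉ α := fun h => (hM M (by simp [h])).false
      rw [List.intercalate_cons_cons, List.append_assoc, List.singleton_append,
        isDescent_succ_append_max hα, List.getD_cons_succ]
      rcases i with _ | i
      · simp only [true_and, List.getD_cons_zero]
        rw [or_iff_left (by simp)]
        rcases β with _ | ⟨b, β⟩
        · simp only [ne_eq, not_true_eq_false, iff_false]
          rintro ⟨b, v, e, hb⟩
          rcases f with _ | ⟨γ, f⟩
          · simp [List.intercalate_singleton] at e
          · rw [List.intercalate_cons_cons] at e
            simp at e
            omega
        · have hb : b < M := hM' b (by simp)
          simp only [ne_eq, reduceCtorEq, not_false_eq_true, iff_true]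
          exact ⟨b, _, List.intercalate_cons_cons_left, hb⟩
      · rw [← ih hM' i]
        simp

theorem isDescent_zero_intercalate_self {f : List (List ℕ)} (hM : ∀ a ∈ f.flatten, a < M)
    (hf : 2 ≤ f.length) : IsDescent ([M].intercalate f) 0 M ↔ f.getD 0 [] ≠ [] := by
  obtain ⟨α, β, g, rfl⟩ : ∃ α β g, f = α :: β :: g := by
    rcases f with _ | ⟨α, _ | ⟨β, g⟩⟩
    · simp at hf
    · simp at hf
    · exact ⟨α, β, g, rfl⟩
  rw [List.intercalate_cons_cons, List.append_assoc, List.singleton_append,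
    isDescent_zero_append_max fun a ha => hM a (by simp [ha])]
  simp

theorem isDescent_intercalate_self {f : List (List ℕ)} (hM : ∀ a ∈ f.flatten, a < M)
    (hf : 2 ≤ f.length) (i : ℕ) : IsDescent ([M].intercalate f) i M ↔ f.getD i [] ≠ [] := by
  rcases i with _ | i
  · exact isDescent_zero_intercalate_self hM hf
  · exact isDescent_succ_intercalate_self hM i

theorem ncard_iUnion_descents {f : List (List ℕ)} (hd : f.Pairwise List.Disjoint) (i : ℕ) :
    {a | ∃ α ∈ f, IsDescent α i a}.ncard = (f.map fun α => (descents α i).ncard).sum := by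
  induction f with
  | nil => simp
  | cons α f ih =>
    rw [List.pairwise_cons] at hd
    have e : {a | ∃ β ∈ α :: f, IsDescent β i a} =
        descents α i ∪ {a | ∃ α ∈ f, IsDescent α i a} := by
      ext a
      simp [descents]
    have hfin : {a | ∃ α ∈ f, IsDescent α i a}.Finite := by
      apply (List.finite_toSet f.flatten).subset
      rintro a ⟨β, hβ, h⟩
      exact List.mem_flatten.mpr ⟨β, hβ, h.mem⟩
    rw [e, Set.ncard_union_eq _ (finite_descents α i) hfin, ih hd.2]
    · simp
    · rw [Set.disjoint_left]
      rintro a ha ⟨β, hβ, h⟩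
      exact hd.1 β hβ (IsDescent.mem ha) h.mem

/-- Descents at smaller letters are inherited from the slots, and `M` adds one exactly when slot i
is nonempty. Thus descents become an additive statistic on trees. -/
theorem ncard_descents_intercalate {f : List (List ℕ)} (hM : ∀ a ∈ f.flatten, a < M)
    (hd : f.Pairwise List.Disjoint) (hf : 2 ≤ f.length) (i : ℕ) :
    (descents ([M].intercalate f) i).ncard =
      (f.map fun α => (descents α i).ncard).sum + if f.getD i [] = [] then 0 else 1 := by
  have hlt : ∀ a, (∃ α ∈ f, IsDescent α i a) → a < M := by
    rintro a ⟨β, hβ, h⟩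
    exact hM a (List.mem_flatten.mpr ⟨β, hβ, h.mem⟩)
  rw [← ncard_iUnion_descents hd]
  have hfin : {a | ∃ α ∈ f, IsDescent α i a}.Finite := (Set.finite_Iio M).subset hlt
  split_ifs with h
  · congr 1
    ext a
    change IsDescent _ i a ↔ _
    by_cases ha : a = M
    · subst ha
      rw [isDescent_intercalate_self hM hf]
      simp only [h, ne_eq, not_true_eq_false, false_iff]
      exact fun h => (hlt a h).false
    · exact isDescent_intercalate_of_ne hM hd ha i
  · rw [← Set.ncard_insert_of_notMem (a := M) (fun h => (hlt M h).false) hfin]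
    congr 1
    ext a
    rw [Set.mem_insert_iff]
    change IsDescent _ i a ↔ _
    by_cases ha : a = M
    · subst ha
      rw [isDescent_intercalate_self hM hf]
      simpa using h
    · rw [isDescent_intercalate_of_ne hM hd ha i]
      simp [ha]

end Descents

/-! ### Monomial weights of trees and forests -/

section Weights

open MvPolynomial

/-- The monomial recording the numbers of descents of each type. -/
noncomputable def descentMonomial (r : ℕ) (w : List ℕ) : MvPolynomial (Fin (r + 1)) ℚ :=
  ∏ i : Fin (r + 1), X i ^ (descents w i).ncard

/-- The variable of the slot that is followed by `d` further slots. -/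
noncomputable def slotVariable (r d : ℕ) : MvPolynomial (Fin (r + 1)) ℚ :=
  X ⟨r - d, by omega⟩

/-- The weight of a list of words that occupy the last slots of a node. -/
noncomputable def forestWeight (r : ℕ) : List (List ℕ) → MvPolynomial (Fin (r + 1)) ℚ
  | [] => 1
  | α :: f => (if α = [] then 1 else slotVariable r f.length) * descentMonomial r α *
      forestWeight r f

theorem descentMonomial_nil (r : ℕ) : descentMonomial r [] = 1 := by
  rw [descentMonomial]
  apply Finset.prod_eq_one
  intro i _
  have : descents [] i = ∅ := Set.eq_empty_of_forall_notMem fun a h => by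
    simpa using IsDescent.mem h
  rw [this, Set.ncard_empty, pow_zero]

theorem descentMonomial_map {r : ℕ} {g : ℕ → ℕ} {w : List ℕ}
    (hg : StrictMonoOn g {a | a ∈ w}) : descentMonomial r (w.map g) = descentMonomial r w := by
  simp only [descentMonomial, ncard_descents_map hg]

theorem forestWeight_map {r : ℕ} {g : ℕ → ℕ} (hg : StrictMono g) (f : List (List ℕ)) :
    forestWeight r (f.map (List.map g)) = forestWeight r f := by
  induction f with
  | nil => rfl
  | cons α f ih =>
    simp only [List.map_cons, forestWeight, ih, descentMonomial_map (hg.strictMonoOn _),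
      List.length_map, List.map_eq_nil_iff]

theorem forestWeight_eq_prod (r : ℕ) (f : List (List ℕ)) :
    forestWeight r f = (f.map (descentMonomial r)).prod *
      ∏ i ∈ Finset.range f.length,
        if f.getD i [] = [] then 1 else slotVariable r (f.length - 1 - i) := by
  induction f with
  | nil => simp [forestWeight]
  | cons α f ih =>
    rw [List.length_cons, Finset.prod_range_succ', forestWeight, ih, List.map_cons, List.prod_cons]
    have : ∏ i ∈ Finset.range f.length,
        (if f.getD i [] = [] then 1 else slotVariable r (f.length - (i + 1))) =
        ∏ i ∈ Finset.range f.length,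
          if f.getD i [] = [] then 1 else slotVariable r (f.length - 1 - i) :=
      Finset.prod_congr rfl fun i _ => by rw [show f.length - (i + 1) = f.length - 1 - i by omega]
    simp only [List.getD_cons_succ, List.getD_cons_zero, Nat.add_sub_cancel, Nat.sub_zero]
    rw [this]
    ring

/-- Slot i is followed by r - i others, so its `slotVariable` is the variable of type i descents. -/
theorem descentMonomial_intercalate {r M : ℕ} (hr : 1 ≤ r) {f : List (List ℕ)}
    (hM : ∀ a ∈ f.flatten, a < M) (hd : f.Pairwise List.Disjoint) (hf : f.length = r + 1) :
    descentMonomial r ([M].intercalate f) = forestWeight r f := by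
  have h1 : ∀ i : Fin (r + 1), (X i : MvPolynomial (Fin (r + 1)) ℚ) ^
      (f.map fun α => (descents α i).ncard).sum =
        (f.map fun α => X i ^ (descents α i).ncard).prod := by
    intro i
    generalize f = f
    induction f with
    | nil => simp
    | cons α f ih => simp [pow_add, ih]
  have h2 : ∏ i : Fin (r + 1), (f.map fun α =>
      (X i : MvPolynomial (Fin (r + 1)) ℚ) ^ (descents α i).ncard).prod =
        (f.map (descentMonomial r)).prod := by
    generalize f = f
    induction f with
    | nil => simp
    | cons α f ih => simp [Finset.prod_mul_distrib, ih, descentMonomial]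
  rw [forestWeight_eq_prod, descentMonomial, hf, Finset.prod_range, ← h2,
    ← Finset.prod_mul_distrib]
  apply Finset.prod_congr rfl
  intro i _
  rw [ncard_descents_intercalate hM hd (by omega), pow_add, h1]
  congr 1
  split_ifs
  · simp
  · rw [pow_one, slotVariable]
    congr 1
    ext
    simp
    omega

end Weights

/-! ### Generating polynomials and the catalytic equations -/

section GeneratingPolynomials

open scoped Polynomial

theorem finite_count_eq (g : ℕ → ℕ) : {w : List ℕ | ∀ a, w.count a = g a}.Finite := by
  by_cases h : ∃ w₀ : List ℕ, ∀ a, w₀.count a = g a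
  · obtain ⟨w₀, h₀⟩ := h
    apply (List.finite_toSet w₀.permutations).subset
    intro w hw
    rw [Set.mem_ofPred_eq, List.mem_permutations, List.perm_iff_count]
    intro a
    rw [hw a, h₀ a]
  · convert Set.finite_empty
    exact Set.eq_empty_of_forall_notMem fun w hw => h ⟨w, hw⟩

theorem finite_sortableTrees {r : ℕ} (hr : 1 ≤ r) (n : ℕ) : (sortableTrees r n).Finite :=
  (finite_count_eq _).subset fun _ hw => ((mem_sortableTrees_iff hr).mp hw).1.1

theorem finite_sortableForests (r d N : ℕ) : (sortableForests r d N).Finite := by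
  have hnot : ∀ f ∈ sortableForests r d N, ∀ α ∈ f, N + 1 ∉ α := by
    intro f hf α hα h
    have := (hf.2.2.2.1 (N + 1)).mp (List.mem_flatten.mpr ⟨α, hα, h⟩)
    omega
  rcases Nat.eq_zero_or_pos d with rfl | hd
  · apply (Set.finite_singleton []).subset
    intro f hf
    exact List.length_eq_zero_iff.mp hf.1
  -- Joining the words with the unused letter N + 1 embeds forests into words of prescribed content.
  · apply Set.Finite.of_finite_image (f := ([N + 1].intercalate ·))
    · apply (finite_count_eq fun a => if a = N + 1 then d - 1 else
        if 1 ≤ a ∧ a ≤ N then r else 0).subset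
      rintro _ ⟨f, hf, rfl⟩ a
      simp only
      split_ifs with h1 h2
      · rw [h1, count_intercalate_self (hnot f hf), hf.1]
      · rw [count_intercalate h1]
        obtain ⟨α, hα, ha⟩ := List.mem_flatten.mp ((hf.2.2.2.1 a).mpr h2)
        rw [count_flatten_of_disjoint hf.2.2.1 hα ha, (hf.2.1 α hα).2 a ha]
      · rw [count_intercalate h1, List.count_eq_zero, hf.2.2.2.1]
        exact h2
    · intro f hf g hg h
      have key : ∀ f ∈ sortableForests r d N, ([N + 1].intercalate f).splitOn (N + 1) = f := by
        intro f hf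
        apply List.splitOn_intercalate _ (hnot f hf)
        rintro rfl
        have := hf.1
        simp at this
        omega
      rw [← key f hf, ← key g hg]
      exact congrArg (List.splitOn (N + 1)) h

/-- `sortableTrees r n` as a finset. -/
noncomputable def treeFinset {r : ℕ} (hr : 1 ≤ r) (n : ℕ) : Finset (List ℕ) :=
  (finite_sortableTrees hr n).toFinset

/-- `sortableForests r d N` as a finset. -/
noncomputable def forestFinset (r d N : ℕ) : Finset (List (List ℕ)) :=
  (finite_sortableForests r d N).toFinset

theorem mem_treeFinset {r : ℕ} {hr : 1 ≤ r} {n : ℕ} {w : List ℕ} :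
    w ∈ treeFinset hr n ↔ w ∈ sortableTrees r n := Set.Finite.mem_toFinset _

theorem mem_forestFinset {r d N : ℕ} {f : List (List ℕ)} :
    f ∈ forestFinset r d N ↔ f ∈ sortableForests r d N := Set.Finite.mem_toFinset _

/-- The generating polynomial of `sortableTrees r n`; the variable marks cut letters. -/
noncomputable def treePoly {r : ℕ} (hr : 1 ≤ r) (n : ℕ) : (MvPolynomial (Fin (r + 1)) ℚ)[X] :=
  ∑ w ∈ treeFinset hr n,
    Polynomial.C (descentMonomial r w) * Polynomial.X ^ (cutLetters (stackSort w)).card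

/-- The generating polynomial of `sortableForests r d N`. -/
noncomputable def forestPoly (r d N : ℕ) : (MvPolynomial (Fin (r + 1)) ℚ)[X] :=
  ∑ f ∈ forestFinset r d N,
    Polynomial.C (forestWeight r f) * Polynomial.X ^ (cutLetters (forestSort f)).card

/-- The factor `X` records the new cut letter n + 1 at the end of the sorted word. -/
theorem treePoly_succ {r : ℕ} (hr : 1 ≤ r) (n : ℕ) :
    treePoly hr (n + 1) = Polynomial.X * forestPoly r (r + 1) n := by
  have himage : treeFinset hr (n + 1) =
      (forestFinset r (r + 1) n).image ([n + 1].intercalate ·) := by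
    ext w
    rw [mem_treeFinset, sortableTrees_succ hr, Finset.mem_image]
    simp only [mem_forestFinset]
    rfl
  rw [treePoly, himage, Finset.sum_image, forestPoly, Finset.mul_sum]
  · apply Finset.sum_congr rfl
    intro f hf
    have hf' := mem_forestFinset.mp hf
    have hlt : ∀ a ∈ f.flatten, a < n + 1 := fun a ha => by
      have := (hf'.2.2.2.1 a).mp ha
      omega
    have hlt' : ∀ a ∈ forestSort f, a < n + 1 := fun a ha => hlt a ((mem_forestSort f).mp ha)
    rw [descentMonomial_intercalate hr hlt hf'.2.2.1 hf'.1,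
      stackSort_intercalate (by rw [hf'.1]; omega) hlt, cutLetters_append_singleton_max hlt',
      Finset.card_insert_of_notMem, pow_succ]
    · ring
    · exact fun h => (hlt' _ (mem_cutLetters.mp h).1).false
  · intro f hf g hg h
    exact injOn_intercalate (mem_forestFinset.mp hf) (mem_forestFinset.mp hg) h

theorem forestPoly_zero (r N : ℕ) : forestPoly r 0 N = if N = 0 then 1 else 0 := by
  have hmem : ∀ f, f ∈ forestFinset r 0 N ↔ f = [] ∧ N = 0 := by
    intro f
    rw [mem_forestFinset]
    constructor
    · intro h
      have hf := List.length_eq_zero_iff.mp h.1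
      refine ⟨hf, ?_⟩
      by_contra hN
      have := (h.2.2.2.1 1).mpr ⟨le_rfl, by omega⟩
      simp [hf] at this
    · rintro ⟨rfl, rfl⟩
      refine ⟨rfl, by simp, by simp, fun a => by simp; omega, ?_⟩
      intro a b c _ _ h
      simp at h
  split_ifs with hN
  · have : forestFinset r 0 N = {[]} := by
      ext f
      rw [hmem]
      simp [hN]
    rw [forestPoly, this, Finset.sum_singleton]
    simp [forestWeight, cutLetters]
  · have : forestFinset r 0 N = ∅ := by
      ext f
      rw [hmem]
      simp [hN]
    rw [forestPoly, this, Finset.sum_empty]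

/-- As `q` runs over 0 and the elements of `s`, the number of elements above it takes each value
from 0 to the cardinality once. -/
theorem sum_insert_zero_pow_card {R : Type*} [CommSemiring R] (y : R) (s : Finset ℕ) (hs : 0 ∉ s) :
    ∑ q ∈ insert 0 s, y ^ (s.filter (q < ·)).card = ∑ i ∈ Finset.range (s.card + 1), y ^ i := by
  induction s using Finset.induction_on_max with
  | empty => simp
  | insert M s hM ih =>
    have hM0 : M ∉ insert 0 s := by
      intro h
      rcases Finset.mem_insert.mp h with h | h
      · exact hs (by simp [h])
      · exact (hM M h).false
    have hMs : M ∉ s := fun h => hM0 (Finset.mem_insert_of_mem h)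
    have hs0 : 0 ∉ s := fun h => hs (Finset.mem_insert_of_mem h)
    have hMpos : 0 < M := Nat.pos_of_ne_zero fun h => hs (by simp [h])
    rw [Finset.insert_comm, Finset.sum_insert hM0, Finset.card_insert_of_notMem hMs,
      Finset.sum_range_succ']
    simp only [pow_succ]
    rw [← Finset.sum_mul, ← ih hs0, Finset.sum_mul, add_comm]
    congr 1
    · apply Finset.sum_congr rfl
      intro q hq
      have hqM : q < M := by
        rcases Finset.mem_insert.mp hq with rfl | hq
        · exact hMpos
        · exact hM q hq
      rw [Finset.filter_insert, if_pos hqM, Finset.card_insert_of_notMem, pow_succ]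
      exact fun h => hMs (Finset.mem_filter.mp h).1
    · rw [Finset.filter_insert, if_neg (lt_irrefl M), Finset.filter_false_of_mem]
      · simp
      · exact fun x hx => (hM x hx).asymm

/-- The triples from which `consForest` assembles the forests with nonempty first word. -/
noncomputable def consForestIndex {r : ℕ} (hr : 1 ≤ r) (d N : ℕ) :
    Finset (Σ _ : ℕ, Σ _ : List ℕ × List (List ℕ), ℕ) :=
  (Finset.Icc 1 N).sigma fun m =>
    (treeFinset hr m ×ˢ forestFinset r d (N - m)).sigma fun x =>
      insert 0 (cutLetters (forestSort x.2))

/-- `consForest` on `consForestIndex`. -/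
def consForestOfIndex (x : Σ _ : ℕ, Σ _ : List ℕ × List (List ℕ), ℕ) : List (List ℕ) :=
  consForest x.1 x.2.2 x.2.1.1 x.2.1.2

theorem mem_consForestIndex {r : ℕ} {hr : 1 ≤ r} {d N m q : ℕ} {T : List ℕ}
    {F : List (List ℕ)} :
    (⟨m, ⟨(T, F), q⟩⟩ : Σ _ : ℕ, Σ _ : List ℕ × List (List ℕ), ℕ) ∈ consForestIndex hr d N ↔
      (1 ≤ m ∧ m ≤ N) ∧ (T ∈ sortableTrees r m ∧ F ∈ sortableForests r d (N - m)) ∧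
        q ∈ insert 0 (cutLetters (forestSort F)) := by
  simp only [consForestIndex, Finset.mem_sigma, Finset.mem_Icc, Finset.mem_product,
    mem_treeFinset, mem_forestFinset]

theorem le_of_mem_insert_cutLetters {r d n q : ℕ} {F : List (List ℕ)}
    (hF : F ∈ sortableForests r d n) (hq : q ∈ insert 0 (cutLetters (forestSort F))) : q ≤ n :=
  ((mem_insert_zero_cutLetters fun a => by rw [mem_forestSort, hF.2.2.2.1]).mp hq).1

theorem toFinset_card_map_headLabel {m q : ℕ} {T : List ℕ} (hT : ∀ a, a ∈ T ↔ 1 ≤ a ∧ a ≤ m) :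
    (T.map (headLabel m q)).toFinset.card = m := by
  have h1 : T.toFinset = Finset.Icc 1 m := by
    ext a
    rw [List.mem_toFinset, hT, Finset.mem_Icc]
  have h2 : (T.map (headLabel m q)).toFinset = T.toFinset.image (headLabel m q) := by
    ext a
    simp
  rw [h2, h1, Finset.card_image_of_injOn, Nat.card_Icc, Nat.add_sub_cancel]
  rw [Finset.coe_Icc]
  exact strictMonoOn_headLabel.injOn

/-- The first word determines m as its number of distinct letters and m + q as its maximum; the
relabellings are then known and injective. -/
theorem injOn_consForestOfIndex {r : ℕ} (hr : 1 ≤ r) (d N : ℕ) :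
    Set.InjOn consForestOfIndex (consForestIndex hr d N) := by
  rintro ⟨m, ⟨⟨T, F⟩, q⟩⟩ h ⟨m', ⟨⟨T', F'⟩, q'⟩⟩ h' e
  rw [Finset.mem_coe, mem_consForestIndex] at h h'
  have hT := h.2.1.1.2.1
  have hT' := h'.2.1.1.2.1
  simp only [consForestOfIndex, consForest, List.cons.injEq] at e
  obtain ⟨e1, e2⟩ := e
  have hm : m = m' := by
    rw [← toFinset_card_map_headLabel (q := q) hT, e1, toFinset_card_map_headLabel hT']
  subst hm
  have hmax : ∀ {T : List ℕ} {q : ℕ}, (∀ a, a ∈ T ↔ 1 ≤ a ∧ a ≤ m) →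
      maxLetter (T.map (headLabel m q)) = m + q := by
    intro T q hT
    have hm := (hT m).mpr ⟨h.1.1, le_rfl⟩
    rw [maxLetter_map (List.ne_nil_of_mem hm)
      (strictMonoOn_headLabel.mono fun a ha => (hT a).mp ha),
      maxLetter_eq hm fun a ha => ((hT a).mp ha).2]
    simp [headLabel]
  have hq : q = q' := by
    have := hmax (q := q) hT
    rw [e1, hmax hT'] at this
    omega
  subst hq
  have hTT : T = T' := by
    have hid : ∀ {T : List ℕ}, (∀ a, a ∈ T ↔ 1 ≤ a ∧ a ≤ m) →
        (T.map (headLabel m q)).map (min · m) = T := by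
      intro T hT
      rw [List.map_map]
      conv_rhs => rw [← List.map_id T]
      apply List.map_congr_left
      intro a ha
      have := (hT a).mp ha
      simp only [Function.comp, headLabel, id]
      split_ifs <;> omega
    rw [← hid hT, e1, hid hT']
  have hFF : F = F' :=
    List.map_injective_iff.mpr (List.map_injective_iff.mpr strictMono_tailLabel.injective) e2
  rw [hTT, hFF]

theorem forestFinset_succ {r : ℕ} (hr : 1 ≤ r) (d N : ℕ) :
    forestFinset r (d + 1) N = (forestFinset r d N).image ([] :: ·) ∪
      (consForestIndex hr d N).image consForestOfIndex := by
  have hnil : ∀ f, [] :: f ∈ sortableForests r (d + 1) N ↔ f ∈ sortableForests r d N := by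
    intro f
    have h1 : IsRWord r [] := ⟨fun a b h => by simp at h, by simp⟩
    simp [sortableForests, h1, stackSort_nil, List.disjoint_nil_left]
  ext f
  rw [mem_forestFinset, Finset.mem_union, Finset.mem_image, Finset.mem_image]
  constructor
  · intro hf
    rcases f with _ | ⟨α, f⟩
    · have := hf.1
      simp at this
    · by_cases hα : α = []
      · subst hα
        exact Or.inl ⟨f, mem_forestFinset.mpr ((hnil f).mp hf), rfl⟩
      · obtain ⟨m, q, T, F, hm, hmN, hq, hT, hF, e⟩ := exists_eq_consForest hα hf
        rw [e] at hf ⊢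
        have := (consForest_mem_iff hm hmN hq hT hF).1.mp hf
        exact Or.inr ⟨⟨m, ⟨(T, F), q⟩⟩, mem_consForestIndex.mpr ⟨⟨hm, hmN⟩, ⟨this.1, this.2.1⟩,
          this.2.2⟩, rfl⟩
  · rintro (⟨f, hf, rfl⟩ | ⟨⟨m, ⟨⟨T, F⟩, q⟩⟩, h, rfl⟩)
    · exact (hnil f).mpr (mem_forestFinset.mp hf)
    · obtain ⟨⟨hm, hmN⟩, ⟨hT, hF⟩, hq⟩ := mem_consForestIndex.mp h
      exact (consForest_mem_iff hm hmN (le_of_mem_insert_cutLetters hF hq) hT.2.1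
        hF.2.2.2.1).1.mpr ⟨hT, hF, hq⟩

theorem sum_weight_consForest {r d N m : ℕ} {T : List ℕ} {F : List (List ℕ)} (hm : 1 ≤ m)
    (hmN : m ≤ N) (hT : T ∈ sortableTrees r m) (hF : F ∈ sortableForests r d (N - m)) :
    ∑ q ∈ insert 0 (cutLetters (forestSort F)),
      Polynomial.C (forestWeight r (consForest m q T F)) *
        Polynomial.X ^ (cutLetters (forestSort (consForest m q T F))).card =
    Polynomial.C (slotVariable r d) *
      (Polynomial.C (descentMonomial r T) * Polynomial.X ^ (cutLetters (stackSort T)).card *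
        (Polynomial.C (forestWeight r F) *
          ∑ i ∈ Finset.range ((cutLetters (forestSort F)).card + 1), Polynomial.X ^ i)) := by
  have h0 : 0 ∉ cutLetters (forestSort F) := fun h => by
    have := (hF.2.2.2.1 0).mp ((mem_forestSort F).mp (mem_cutLetters.mp h).1)
    omega
  have hTne : T ≠ [] := List.ne_nil_of_mem ((hT.2.1 1).mpr ⟨le_rfl, hm⟩)
  have hw : ∀ q, forestWeight r (consForest m q T F) =
      slotVariable r d * descentMonomial r T * forestWeight r F := by
    intro q
    rw [consForest, forestWeight, if_neg (by simpa using hTne), List.length_map, hF.1,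
      forestWeight_map strictMono_tailLabel, descentMonomial_map]
    exact strictMonoOn_headLabel.mono fun a ha => (hT.2.1 a).mp ha
  rw [← sum_insert_zero_pow_card _ _ h0, ← mul_assoc, ← mul_assoc, Finset.mul_sum]
  apply Finset.sum_congr rfl
  intro q hq
  rw [hw, (consForest_mem_iff (r := r) (d := d) hm hmN (le_of_mem_insert_cutLetters hF hq) hT.2.1
    hF.2.2.2.1).2 hq, pow_add, map_mul, map_mul]
  ring

-- The new slot is either empty or holds a tree, whose root has one admissible level for each term
-- of the geometric sum.
set_option maxHeartbeats 1600000 in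
theorem forestPoly_succ {r : ℕ} (hr : 1 ≤ r) (d N : ℕ) :
    forestPoly r (d + 1) N = forestPoly r d N + Polynomial.C (slotVariable r d) *
      ∑ m ∈ Finset.Icc 1 N, treePoly hr m * ∑ F ∈ forestFinset r d (N - m),
        Polynomial.C (forestWeight r F) *
          ∑ i ∈ Finset.range ((cutLetters (forestSort F)).card + 1), Polynomial.X ^ i := by
  rw [forestPoly, forestFinset_succ hr, Finset.sum_union, Finset.sum_image, Finset.sum_image]
  · congr 1
    · rw [forestPoly]
      apply Finset.sum_congr rfl
      intro f _
      rw [forestWeight, descentMonomial_nil, if_pos rfl, one_mul, one_mul, forestSort_cons,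
        stackSort_nil, List.nil_append]
    · rw [consForestIndex, Finset.sum_sigma, Finset.mul_sum]
      apply Finset.sum_congr rfl
      intro m hm
      rw [Finset.mem_Icc] at hm
      rw [Finset.sum_sigma, Finset.sum_product, treePoly, Finset.sum_mul_sum, Finset.mul_sum]
      apply Finset.sum_congr rfl
      intro T hT
      rw [Finset.mul_sum]
      apply Finset.sum_congr rfl
      intro F hF
      exact sum_weight_consForest hm.1 hm.2 (mem_treeFinset.mp hT) (mem_forestFinset.mp hF)
  · exact injOn_consForestOfIndex hr d N
  · intro f _ g _ h
    simpa using h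
  · rw [Finset.disjoint_left]
    intro f hf hf'
    obtain ⟨g, _, rfl⟩ := Finset.mem_image.mp hf
    obtain ⟨⟨m, ⟨⟨T, F⟩, q⟩⟩, h, e⟩ := Finset.mem_image.mp hf'
    obtain ⟨⟨hm, -⟩, ⟨hT, -⟩, -⟩ := mem_consForestIndex.mp h
    simp only [consForestOfIndex, consForest, List.cons.injEq, List.map_eq_nil_iff] at e
    have := (hT.2.1 1).mpr ⟨le_rfl, hm⟩
    simp [e.1] at this

/-- The generating series of two-stack-sortable `r`-permutations. -/
noncomputable def treeSeries {r : ℕ} (hr : 1 ≤ r) :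
    PowerSeries (MvPolynomial (Fin (r + 1)) ℚ)[X] :=
  PowerSeries.mk fun n => if n = 0 then 0 else treePoly hr n

/-- The generating series of forests. -/
noncomputable def forestSeries (r d : ℕ) : PowerSeries (MvPolynomial (Fin (r + 1)) ℚ)[X] :=
  PowerSeries.mk fun N => forestPoly r d N

/-- Multiplication by 1 - y telescopes 1 + y + ⋯ + yᶜ to 1 - y·yᶜ; summed over forests with c cut
letters, this is H(1) - y H. -/
theorem catalyticSystem_treeSeries {r : ℕ} (hr : 1 ≤ r) :
    CatalyticSystem ((Polynomial.C : MvPolynomial (Fin (r + 1)) ℚ →+* _).comp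
      (Polynomial.evalRingHom 1)) Polynomial.X (fun j => Polynomial.C (slotVariable r j)) (r + 1)
      PowerSeries.X (treeSeries hr) (forestSeries r) := by
  refine ⟨?_, fun d _ => ?_, ?_⟩
  · ext N
    rw [forestSeries, PowerSeries.coeff_mk, forestPoly_zero, PowerSeries.coeff_one]
  · have hgeom : ∀ N, (1 - Polynomial.X) * ∑ F ∈ forestFinset r d N,
        Polynomial.C (forestWeight r F) *
          ∑ i ∈ Finset.range ((cutLetters (forestSort F)).card + 1), Polynomial.X ^ i =
        Polynomial.C ((forestPoly r d N).eval 1) - Polynomial.X * forestPoly r d N := by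
      intro N
      rw [Finset.mul_sum, forestPoly, Polynomial.eval_finsetSum, map_sum, Finset.mul_sum,
        ← Finset.sum_sub_distrib]
      apply Finset.sum_congr rfl
      intro F _
      have := mul_neg_geom_sum (Polynomial.X : (MvPolynomial (Fin (r + 1)) ℚ)[X])
        ((cutLetters (forestSort F)).card + 1)
      simp only [Polynomial.eval_mul, Polynomial.eval_C, Polynomial.eval_pow, Polynomial.eval_X,
        one_pow, mul_one]
      linear_combination Polynomial.C (forestWeight r F) * this
    ext1 N
    rw [mul_assoc, PowerSeries.coeff_C_mul, PowerSeries.coeff_C_mul, map_sub,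
      PowerSeries.coeff_mul, Finset.Nat.sum_antidiagonal_eq_sum_range_succ_mk,
      Finset.sum_range_succ', forestSeries, forestSeries, PowerSeries.coeff_mk,
      PowerSeries.coeff_mk, forestPoly_succ hr, add_sub_cancel_left, mul_left_comm]
    congr 1
    rw [Finset.mul_sum]
    -- The empty tree is excluded from the series, since an empty slot is already counted by the
    -- term H_j.
    have h0 : PowerSeries.coeff 0 (treeSeries hr) = 0 := by
      rw [treeSeries, PowerSeries.coeff_mk, if_pos rfl]
    rw [h0, zero_mul, add_zero, ← Finset.Ico_succ_right_eq_Icc, Finset.sum_Ico_eq_sum_range]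
    apply Finset.sum_congr rfl
    intro m _
    rw [add_comm 1 m, mul_left_comm, hgeom, treeSeries, PowerSeries.coeff_mk,
      if_neg (Nat.succ_ne_zero m), map_sub, PowerSeries.coeff_C_mul, PowerSeries.coeff_map,
      PowerSeries.coeff_mk]
    rfl
  · ext1 n
    rw [mul_assoc]
    rcases n with _ | n
    · simp [treeSeries]
    · rw [PowerSeries.coeff_succ_X_mul, PowerSeries.coeff_C_mul, treeSeries, forestSeries,
        PowerSeries.coeff_mk, PowerSeries.coeff_mk, if_neg (Nat.succ_ne_zero n), treePoly_succ]

end GeneratingPolynomials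

/-! ### Coefficient extraction and the count -/

section Enumeration

open MvPolynomial

theorem coeff_catalanFactorInv_X_pow {r N l : ℕ} (hl : l < N) (i : Fin (r + 1)) :
    PowerSeries.coeff l ((catalanFactorInv (X i : MvPolynomial (Fin (r + 1)) ℚ) ^ 2) ^ N) =
      C ((N : ℚ) / ((N : ℚ) - l) * (Nat.choose (2 * N - 1 - l) l : ℚ)) * X i ^ l := by
  have h := coeff_catalanFactorInv_pow (X i : MvPolynomial (Fin (r + 1)) ℚ) hl
  have hne : (N : ℚ) - l ≠ 0 := by
    have : (l : ℚ) < N := by exact_mod_cast hl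
    linarith
  have e : (C ((N : ℚ) - l) : MvPolynomial (Fin (r + 1)) ℚ) = (N : MvPolynomial (Fin (r + 1)) ℚ) - l := by
    simp
  rw [← e] at h
  have hC : (C ((N : ℚ) - l)⁻¹ : MvPolynomial (Fin (r + 1)) ℚ) * C ((N : ℚ) - l) = 1 := by
    rw [← C_mul, inv_mul_cancel₀ hne, C_1]
  have h2 := congrArg (C ((N : ℚ) - l)⁻¹ * ·) h
  simp only [← mul_assoc, hC, one_mul] at h2
  rw [h2, div_eq_inv_mul, C_mul, C_mul]
  simp

/-- Each factor carries its own variable, and its coefficient of tˡ is a rational multiple of X_iˡ.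
Hence every composition of m contributes exactly one monomial. -/
theorem coeff_coeff_prod_catalanFactorInv (r m : ℕ) (κ : Fin (r + 1) →₀ ℕ) :
    MvPolynomial.coeff κ (PowerSeries.coeff m
      ((∏ i ∈ Finset.range (r + 1), catalanFactorInv (slotVariable r i) ^ 2) ^ (m + 1))) =
      if ∑ i, κ i = m then ∏ i, (((m + 1 : ℕ) : ℚ) / (((m + 1 : ℕ) : ℚ) - (κ i : ℚ)) *
        (Nat.choose (2 * (m + 1) - 1 - κ i) (κ i) : ℚ)) else 0 := by
  have hprod : ∏ i ∈ Finset.range (r + 1), catalanFactorInv (slotVariable r i) ^ 2 =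
      ∏ i : Fin (r + 1), catalanFactorInv (X i : MvPolynomial (Fin (r + 1)) ℚ) ^ 2 := by
    rw [Finset.prod_range]
    -- Slots are filled from the right, so `slotVariable` lists the variables in reverse order.
    refine Fintype.prod_equiv Fin.revPerm _ _ fun i => ?_
    rw [slotVariable, Fin.revPerm_apply]
    congr 3
    ext
    simp [Fin.val_rev]
  rw [hprod, ← Finset.prod_pow, PowerSeries.coeff_prod]
  have hterm : ∀ l ∈ Finset.univ.finsuppAntidiag m, ∏ i : Fin (r + 1),
      PowerSeries.coeff (l i)
        ((catalanFactorInv (X i : MvPolynomial (Fin (r + 1)) ℚ) ^ 2) ^ (m + 1)) =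
      monomial l (∏ i, (((m + 1 : ℕ) : ℚ) / (((m + 1 : ℕ) : ℚ) - (l i : ℚ)) *
        (Nat.choose (2 * (m + 1) - 1 - l i) (l i) : ℚ))) := by
    intro l hl
    rw [Finset.mem_finsuppAntidiag] at hl
    have hle : ∀ i, l i < m + 1 := fun i => by
      have := Finset.single_le_sum (f := fun i => l i) (fun _ _ => Nat.zero_le _)
        (Finset.mem_univ i)
      have h2 : ∑ x, l x = m := hl.1
      omega
    rw [Finset.prod_congr rfl fun i _ => coeff_catalanFactorInv_X_pow (hle i) i,
      Finset.prod_mul_distrib, ← map_prod, monomial_eq, Finsupp.prod_fintype _ _ (by simp)]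
  rw [Finset.sum_congr rfl hterm, MvPolynomial.coeff_sum]
  simp only [MvPolynomial.coeff_monomial]
  rw [Finset.sum_ite_eq']
  simp [Finset.mem_finsuppAntidiag]

theorem coeff_eval_one_treePoly {r : ℕ} (hr : 1 ≤ r) (n : ℕ) (κ : Fin (r + 1) →₀ ℕ) :
    MvPolynomial.coeff κ ((treePoly hr n).eval 1) =
      ({w | w ∈ sortableTrees r n ∧ ∀ i : Fin (r + 1), (descents w i).ncard = κ i}.ncard : ℚ) := by
  classical
  have hmon : ∀ w, descentMonomial r w = monomial
      (Finsupp.equivFunOnFinite.symm fun i : Fin (r + 1) => (descents w i).ncard) (1 : ℚ) := by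
    intro w
    rw [monomial_eq, Finsupp.prod_fintype _ _ (by simp), descentMonomial]
    simp
  have hiff : ∀ w, (Finsupp.equivFunOnFinite.symm fun i : Fin (r + 1) => (descents w i).ncard) = κ ↔
      ∀ i : Fin (r + 1), (descents w i).ncard = κ i := by
    intro w
    rw [Finsupp.ext_iff]
    rfl
  have hset : {w | w ∈ sortableTrees r n ∧ ∀ i : Fin (r + 1), (descents w i).ncard = κ i} =
      ((treeFinset hr n).filter fun w => ∀ i : Fin (r + 1), (descents w i).ncard = κ i) := by
    ext w
    simp [mem_treeFinset]
  rw [hset, Set.ncard_coe_finset, treePoly, Polynomial.eval_finsetSum, MvPolynomial.coeff_sum,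
    Finset.card_filter]
  push_cast
  apply Finset.sum_congr rfl
  intro w _
  simp only [Polynomial.eval_mul, Polynomial.eval_C, Polynomial.eval_pow, Polynomial.eval_X,
    one_pow, mul_one, hmon, MvPolynomial.coeff_monomial, hiff]

theorem sq_mul_ncard_sortableTrees {r : ℕ} (hr : 1 ≤ r) (m : ℕ) (k : Fin (r + 1) → ℕ) :
    ((m + 1 : ℕ) : ℚ) ^ 2 * ({w | w ∈ sortableTrees r (m + 1) ∧
        ∀ i : Fin (r + 1), (descents w i).ncard = k i}.ncard : ℚ) =
      if ∑ i, k i = m then ∏ i, (((m + 1 : ℕ) : ℚ) / (((m + 1 : ℕ) : ℚ) - (k i : ℚ)) *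
        (Nat.choose (2 * (m + 1) - 1 - k i) (k i) : ℚ)) else 0 := by
  set κ : Fin (r + 1) →₀ ℕ := Finsupp.equivFunOnFinite.symm k with hκ
  have hk : ∀ i, κ i = k i := fun i => rfl
  have h := congrArg (MvPolynomial.coeff κ)
    (sq_mul_coeff_of_catalyticSystem (catalyticSystem_treeSeries hr) m)
  rw [coeff_coeff_prod_catalanFactorInv, treeSeries, PowerSeries.coeff_mk,
    if_neg (Nat.succ_ne_zero m)] at h
  have e : (((m + 1 : ℕ) : MvPolynomial (Fin (r + 1)) ℚ)) ^ 2 = C (((m + 1 : ℕ) : ℚ) ^ 2) := by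
    simp
  rw [e, MvPolynomial.coeff_C_mul, coeff_eval_one_treePoly] at h
  simp only [hk] at h
  exact h

/-- The size is forced by the descents: the coefficient of tᵐ is homogeneous of degree m in the
variables, so the count for any other size is zero. -/
theorem twoStackSortableWithDescents_eq {r : ℕ} (hr : 1 ≤ r) (k : Fin (r + 1) → ℕ) :
    twoStackSortableWithDescents r k = {w | w ∈ sortableTrees r (∑ i, k i + 1) ∧
      ∀ i : Fin (r + 1), (descents w i).ncard = k i} := by
  ext w
  constructor
  · rintro ⟨⟨m, hm, hw⟩, hd⟩
    obtain ⟨m, rfl⟩ : ∃ m', m = m' + 1 := ⟨m - 1, by omega⟩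
    have hw' := (mem_sortableTrees_iff hr).mpr hw
    by_cases hmk : ∑ i, k i = m
    · rw [hmk]
      exact ⟨hw', hd⟩
    · have h := sq_mul_ncard_sortableTrees hr m k
      rw [if_neg hmk] at h
      have h0 := (mul_eq_zero.mp h).resolve_left (by positivity)
      have hfin : {w | w ∈ sortableTrees r (m + 1) ∧
          ∀ i : Fin (r + 1), (descents w i).ncard = k i}.Finite :=
        (finite_sortableTrees hr (m + 1)).subset fun _ h => h.1
      rw [Nat.cast_eq_zero, Set.ncard_eq_zero hfin] at h0
      have : w ∈ (∅ : Set (List ℕ)) := h0 ▸ ⟨hw', hd⟩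
      exact this.elim
  · rintro ⟨hw, hd⟩
    exact ⟨⟨_, by omega, (mem_sortableTrees_iff hr).mp hw⟩, hd⟩

theorem ncard_twoStackSortableWithDescents {r : ℕ} (hr : 1 ≤ r) (k : Fin (r + 1) → ℕ) (n : ℕ)
    (hn : n = 1 + ∑ i, k i) :
    ((twoStackSortableWithDescents r k).ncard : ℚ) =
      1 / (n : ℚ) ^ 2 *
        ∏ i, ((n : ℚ) / ((n : ℚ) - (k i : ℚ)) * (Nat.choose (2 * n - 1 - k i) (k i) : ℚ)) := by
  have h := sq_mul_ncard_sortableTrees hr (∑ i, k i) k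
  rw [if_pos rfl, ← twoStackSortableWithDescents_eq hr, add_comm (∑ i, k i) 1, ← hn] at h
  rw [← h]
  have : (n : ℚ) ≠ 0 := by
    rw [Nat.cast_ne_zero]
    omega
  field_simp

end Enumeration

/-! ### The theorem and its case r = 1 -/

theorem mainTheorem1 :
    (∀ (r : ℕ), 1 ≤ r → ∀ (k : Fin (r + 1) → ℕ) (n : ℕ), n = 1 + ∑ i, k i →
      ((twoStackSortableWithDescents r k).ncard : ℚ) =
        1 / (n : ℚ) ^ 2 *
          ∏ i, ((n : ℚ) / ((n : ℚ) - (k i : ℚ)) * (Nat.choose (2 * n - 1 - k i) (k i) : ℚ))) ∧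
    (∀ k₀ k₁ n : ℕ, n = 1 + k₀ + k₁ →
      ((twoStackSortableWithDescents 1 ![k₀, k₁]).ncard : ℚ) =
        ((n + k₁).factorial * (2 * n - 1 - k₁).factorial : ℚ) /
          ((k₁ + 1).factorial * (2 * k₁ + 1).factorial *
            (n - k₁).factorial * (2 * n - 1 - 2 * k₁).factorial : ℚ)) := by
  refine ⟨fun r hr k n hn => ncard_twoStackSortableWithDescents hr k n hn, ?_⟩
  rintro k₀ k₁ n rfl
  rw [ncard_twoStackSortableWithDescents le_rfl ![k₀, k₁] (1 + k₀ + k₁)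
    (by rw [Fin.sum_univ_two]; simp [add_assoc]), Fin.prod_univ_two]
  simp only [Matrix.cons_val_zero, Matrix.cons_val_one]
  -- Eliminating n turns both binomials into the form (a + b choose b), hence into quotients of
  -- factorials.
  have e1 : 2 * (1 + k₀ + k₁) - 1 - k₀ = (2 * k₁ + 1) + k₀ := by omega
  have e2 : 2 * (1 + k₀ + k₁) - 1 - k₁ = (2 * k₀ + 1) + k₁ := by omega
  have e3 : 1 + k₀ + k₁ + k₁ = (2 * k₁ + 1) + k₀ := by omega
  have e4 : 1 + k₀ + k₁ - k₁ = k₀ + 1 := by omega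
  have e5 : 2 * (1 + k₀ + k₁) - 1 - 2 * k₁ = 2 * k₀ + 1 := by omega
  rw [e1, e2, e3, e4, e5, Nat.add_choose, Nat.add_choose,
    Nat.cast_div (Nat.factorial_mul_factorial_dvd_factorial_add _ _) (by positivity),
    Nat.cast_div (Nat.factorial_mul_factorial_dvd_factorial_add _ _) (by positivity)]
  have h0 : ((1 + k₀ + k₁ : ℕ) : ℚ) - (k₀ : ℚ) = k₁ + 1 := by push_cast; ring
  have h1 : ((1 + k₀ + k₁ : ℕ) : ℚ) - (k₁ : ℚ) = k₀ + 1 := by push_cast; ring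
  rw [h0, h1, Nat.factorial_succ k₁, Nat.factorial_succ k₀]
  have hn : ((1 + k₀ + k₁ : ℕ) : ℚ) ≠ 0 := by positivity
  push_cast
  field_simp
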